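/- Conventions. Let $\mathbb{R}^+=[0,\infty)$. A \emph{dimension function} is a left continuous, non-decreasing function $f:\mathbb{R}^+\to\mathbb{R}^+$ with $f(r)\to0$ as $r\to0$. In a metric space $(X,d)$ write $B(x,r)=\{y: d(x,y)<r\}$, and for $E\subset X$ let $$\mathcal{H}^f(E)=\lim_{\rho\to0}\ \inf\Big\{\sum_i f(r_i):\ E\subset\bigcup_i B(x_i,r_i),\ r_i<\rho\Big\},$$ the infimum being over countable families of balls (it is $+\infty$ if there is no such family). For $F\subset X$ and $\delta\ge0$ let $\Delta(F,\delta)=\{x\in X: d(x,F)<\delta\}$, where $d(x,F)=\inf_{y\in F}d(x,y)$, and $\Delta(\emptyset,\delta)=\emptyset$. Given sets $F_j\subset X$ $(j\in\mathbb{N})$ and a sequence $\Upsilon=(\Upsilon_j)$ of non-negative reals, let $$\Lambda(\Upsilon)=\{x\in X: x\in\Delta(F_j,\Upsilon_j)\text{ for infinitely many }j\}.$$ Theorem. Let $(X,d)$ be a locally compact metric space. Let $g$ be a dimension function that is doubling, i.e. there is $\lambda>1$ with $g(2x)<\lambda g(x)$ for all $x>0$, and suppose that there are constants $0<c_1<1<c_2<\infty$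 and $r_0>0$ such that $$c_1g(r)\le\mathcal{H}^g(B(x,r))\le c_2g(r)\qquad\text{for all }x\in X,\ 0<r<r_0.$$ Let $0\le\kappa<1$ and let $(F_j)_{j\in\mathbb{N}}$ be a sequence of subsets of $X$ satisfying the local scaling property with respect to $\kappa$: there are constants $c_3,c_4,r_1>0$ such that for all $0<r<r_1$, $0\le\delta<r$, $j\in\mathbb{N}$ and $x\in F_j$, $$c_3\,g(\delta)^{1-\kappa}g(r)^{\kappa}\le\mathcal{H}^g\big(B(x,r)\cap\Delta(F_j,\delta)\big)\le c_4\,g(\delta)^{1-\kappa}g(r)^{\kappa}.$$ Let $\Upsilon=(\Upsilon_j)$ be a sequence of non-negative reals with $\Upsilon_j\to0$. Let $f$ be a dimension function such that $f/g$ is monotonic on $(0,\infty)$ and $f/g^{\kappa}$ (given the value $0$ at $0$) is a dimension function. Put $$\tilde\Upsilon_j=g^{-1}\left(\left(\frac{f(\Upsilon_j)}{g(\Upsilon_j)^{\kappa}}\right)^{\frac1{1-\kappa}}\right),\qquad g^{-1}(y):=\sup\{r\ge0: g(r)\le y\},$$ so that $g^{-1}$ is the usual inverse when $g$ is a bijection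 of $\mathbb{R}^+$. (If $g$ is bounded, the supremum may be infinite for finitely many $j$; the value used for these $j$ is irrelevant.) Suppose that for every ball $B$ in $X$ $$\mathcal{H}^g\big(B\cap\Lambda(\tilde\Upsilon)\big)=\mathcal{H}^g(B).$$ Then for every ball $B$ in $X$ $$\mathcal{H}^f\big(B\cap\Lambda(\Upsilon)\big)=\mathcal{H}^f(B).$$ -/

import Mathlib

open Set Filter Topology
open scoped NNReal ENNReal

namespace MTP

/-- A dimension function: a left continuous, non-decreasing function `f : [0, ∞) → [0, ∞)` with
`f r → 0` as `r → 0`. -/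
structure IsDimensionFunction (f : ℝ≥0 → ℝ≥0) : Prop where
  leftCts : ∀ r : ℝ≥0, ContinuousWithinAt f (Iio r) r
  mono : Monotone f
  tendsto_zero : Tendsto f (𝓝[>] 0) (𝓝 0)

/-- `f` is doubling: for some `lam > 1` one has `f (2 x) < lam * f x` for all `x > 0`. -/
def IsDoubling (f : ℝ≥0 → ℝ≥0) : Prop :=
  ∃ lam : ℝ≥0, 1 < lam ∧ ∀ x : ℝ≥0, 0 < x → f (2 * x) < lam * f x

/-- A `ρ`-cover of `E`: a countable collection of balls, given by pairs (centre, radius), with radii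
less than `ρ`, whose union contains `E`. -/
def IsRhoCover {X : Type*} [MetricSpace X] (ρ : ℝ≥0) (E : Set X) (C : Set (X × ℝ≥0)) : Prop :=
  C.Countable ∧ (∀ p ∈ C, p.2 < ρ) ∧ E ⊆ ⋃ p ∈ C, Metric.ball p.1 (p.2 : ℝ)

/-- The infimum of `∑ f (radius)` over all `ρ`-covers of `E`. -/
noncomputable def hausdorffPre {X : Type*} [MetricSpace X] (f : ℝ≥0 → ℝ≥0) (ρ : ℝ≥0)
    (E : Set X) : ℝ≥0∞ :=
  ⨅ (C : Set (X × ℝ≥0)) (_ : IsRhoCover ρ E C), ∑' p : C, (f p.1.2 : ℝ≥0∞)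

/-- The Hausdorff `f`-measure of `E`: the limit of `hausdorffPre f ρ E` as `ρ → 0`, which is the
supremum over `ρ > 0` since `hausdorffPre` is non-increasing in `ρ`. -/
noncomputable def hausdorffMeas {X : Type*} [MetricSpace X] (f : ℝ≥0 → ℝ≥0) (E : Set X) : ℝ≥0∞ :=
  ⨆ (ρ : ℝ≥0) (_ : 0 < ρ), hausdorffPre f ρ E

/-- The Hausdorff `g`-measure of a ball of small radius `r` is comparable to `g r`, uniformly in the
centre. -/
def BallMeasureComparable (X : Type*) [MetricSpace X] (g : ℝ≥0 → ℝ≥0) : Prop :=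
  ∃ c₁ c₂ r₀ : ℝ≥0, 0 < c₁ ∧ c₁ < 1 ∧ 1 < c₂ ∧ 0 < r₀ ∧
    ∀ (x : X) (r : ℝ≥0), 0 < r → r < r₀ →
      ((c₁ * g r : ℝ≥0) : ℝ≥0∞) ≤ hausdorffMeas g (Metric.ball x (r : ℝ)) ∧
      hausdorffMeas g (Metric.ball x (r : ℝ)) ≤ ((c₂ * g r : ℝ≥0) : ℝ≥0∞)

/-- The `δ`-neighbourhood `{x | d(x, F) < δ}` (which is empty if `F` is empty). -/
def nbhd {X : Type*} [MetricSpace X] (F : Set X) (δ : ℝ≥0) : Set X :=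
  Metric.thickening (δ : ℝ) F

/-- The local scaling property of the sequence of sets `F` with respect to `κ` (and `g`). -/
def LocalScaling {X : Type*} [MetricSpace X] (g : ℝ≥0 → ℝ≥0) (F : ℕ → Set X) (κ : ℝ) : Prop :=
  ∃ c₃ c₄ r₁ : ℝ≥0, 0 < c₃ ∧ 0 < c₄ ∧ 0 < r₁ ∧
    ∀ (r δ : ℝ≥0), 0 < r → r < r₁ → δ < r → ∀ (j : ℕ), ∀ x ∈ F j,
      ((c₃ * (g δ ^ (1 - κ) * g r ^ κ) : ℝ≥0) : ℝ≥0∞) ≤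
        hausdorffMeas g (Metric.ball x (r : ℝ) ∩ nbhd (F j) δ) ∧
      hausdorffMeas g (Metric.ball x (r : ℝ) ∩ nbhd (F j) δ) ≤
        ((c₄ * (g δ ^ (1 - κ) * g r ^ κ) : ℝ≥0) : ℝ≥0∞)

/-- The points lying in `nbhd (F j) (Υ j)` for infinitely many `j`. -/
def limsupSet {X : Type*} [MetricSpace X] (F : ℕ → Set X) (Υ : ℕ → ℝ≥0) : Set X :=
  {x | {j : ℕ | x ∈ nbhd (F j) (Υ j)}.Infinite}

/-- The inverse of a non-decreasing left continuous function `g`: the largest `r` with `g r ≤ y`.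
It is the ordinary inverse where `g` is a bijection. If `g` takes the value `y` at several points,
it is the largest of them, so neighbourhoods with this radius contain those for any other choice. -/
noncomputable def genInv (g : ℝ≥0 → ℝ≥0) (y : ℝ≥0) : ℝ≥0 :=
  sSup {r : ℝ≥0 | g r ≤ y}

end MTP

open MeasureTheory

namespace MTP

/-! ### Hausdorff measures as metric outer measures. -/

section OuterMeasure

variable {X : Type*} [MetricSpace X]

/-! Write `Υ'` for the transformed radii. Since `f / g` is monotonic, either `f ≤ K * g` near `0` or
`f / g` tends to infinity at `0`.

In the bounded case `g (Υ' j)` is eventually at most a constant times `g (Υ j)`. Shrinking `Υ'` to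
`Υ` then loses only a `g`-null set: at a lost point, the parts of the smaller neighbourhoods near it
have positive upper density, which `hausdorffMeas_le_of_density` (a Vitali covering argument)
forbids outside a null set. As `f ≤ K * g`, `g`-null sets are `f`-null, and
`hausdorffMeas_ball_inter_eq` passes from small balls to all balls.

In the unbounded case the `f`-measure of the limsup set in a ball is infinite. Otherwise the set has
a cover `C` of bounded `f`-mass by balls so small that the `g`-mass of `C` is at most `ε * g R`. One
builds nested closed balls, lying in neighbourhoods of radius `Υ j` with `j` arbitrarily large, such
that the balls of `C` hitting the current ball, of radius `r`, have `g`-mass at most `ε * g r`; in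
particular each of them is smaller than that ball. By local compactness the nested balls have a
common point. It lies in the limsup set, so a ball of `C` contains it; that ball hits all the nested
balls, so its radius is below radii tending to `0`, a contradiction.

The invariant is passed on by `exists_next_ball`. Some point `x` of the limsup set for `Υ'` avoids
the enlarged hitting balls and sees zero upper density of `f`-mass, so the balls of `C` relevant
near `x` have `f`-mass much less than `g (Υ' j)`. The choice of `Υ'` makes this exactly the
smallness needed in `exists_point_few_hits`, which averages over the neighbourhood of `F j` of
radius `Υ j / 2` by means of local scaling and finds the centre of the next ball. -/

theorem exists_cover_of_hausdorffPre_lt {f : ℝ≥0 → ℝ≥0} {ρ : ℝ≥0} {E : Set X} {a : ℝ≥0∞}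
    (h : hausdorffPre f ρ E < a) :
    ∃ C : Set (X × ℝ≥0), IsRhoCover ρ E C ∧ ∑' p : C, (f p.1.2 : ℝ≥0∞) < a := by
  simpa only [hausdorffPre, iInf_lt_iff, exists_prop] using h

theorem hausdorffPre_le_tsum (f : ℝ≥0 → ℝ≥0) {ρ : ℝ≥0} {E : Set X} {C : Set (X × ℝ≥0)}
    (hC : IsRhoCover ρ E C) : hausdorffPre f ρ E ≤ ∑' p : C, (f p.1.2 : ℝ≥0∞) :=
  iInf₂_le C hC

theorem hausdorffPre_le_hausdorffMeas (f : ℝ≥0 → ℝ≥0) {ρ : ℝ≥0} (hρ : 0 < ρ) (E : Set X) :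
    hausdorffPre f ρ E ≤ hausdorffMeas f E :=
  le_iSup₂ (f := fun ρ (_ : 0 < ρ) => hausdorffPre f ρ E) ρ hρ

theorem hausdorffPre_anti (f : ℝ≥0 → ℝ≥0) {ρ ρ' : ℝ≥0} (h : ρ ≤ ρ') (E : Set X) :
    hausdorffPre f ρ' E ≤ hausdorffPre f ρ E :=
  le_iInf₂ fun _ hC => hausdorffPre_le_tsum f ⟨hC.1, fun p hp => (hC.2.1 p hp).trans_le h, hC.2.2⟩

theorem hausdorffPre_mono (f : ℝ≥0 → ℝ≥0) (ρ : ℝ≥0) {E E' : Set X} (h : E ⊆ E') :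
    hausdorffPre f ρ E ≤ hausdorffPre f ρ E' :=
  le_iInf₂ fun _ hC => hausdorffPre_le_tsum f ⟨hC.1, hC.2.1, h.trans hC.2.2⟩

theorem hausdorffPre_empty (f : ℝ≥0 → ℝ≥0) (ρ : ℝ≥0) : hausdorffPre f ρ (∅ : Set X) = 0 := by
  refine le_antisymm ((hausdorffPre_le_tsum f (C := ∅) ⟨countable_empty, ?_, ?_⟩).trans ?_) bot_le
  · simp
  · simp
  · simp

theorem hausdorffPre_iUnion_le (f : ℝ≥0 → ℝ≥0) (ρ : ℝ≥0) (s : ℕ → Set X) :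
    hausdorffPre f ρ (⋃ i, s i) ≤ ∑' i, hausdorffPre f ρ (s i) := by
  refine ENNReal.le_of_forall_pos_le_add fun ε hε hfin => ?_
  obtain ⟨ε', hε', hsum⟩ := ENNReal.exists_pos_sum_of_countable
    (ENNReal.coe_ne_zero.2 hε.ne') ℕ
  have h1 : ∀ i, ∃ C : Set (X × ℝ≥0), IsRhoCover ρ (s i) C ∧
      ∑' p : C, (f p.1.2 : ℝ≥0∞) < hausdorffPre f ρ (s i) + ε' i := fun i =>
    exists_cover_of_hausdorffPre_lt <| ENNReal.lt_add_right
      (ENNReal.ne_top_of_tsum_ne_top hfin.ne i) (ENNReal.coe_ne_zero.2 (hε' i).ne')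
  choose C hC hCsum using h1
  have hcov : IsRhoCover ρ (⋃ i, s i) (⋃ i, C i) := by
    refine ⟨countable_iUnion fun i => (hC i).1, ?_, ?_⟩
    · intro p hp
      obtain ⟨i, hi⟩ := mem_iUnion.1 hp
      exact (hC i).2.1 p hi
    · refine iUnion_subset fun i => (hC i).2.2.trans ?_
      exact biUnion_subset_biUnion_left (subset_iUnion C i)
  calc hausdorffPre f ρ (⋃ i, s i) ≤ ∑' p : ⋃ i, C i, (f p.1.2 : ℝ≥0∞) :=
        hausdorffPre_le_tsum f hcov
    _ ≤ ∑' i, ∑' p : C i, (f p.1.2 : ℝ≥0∞) :=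
        ENNReal.tsum_iUnion_le_tsum (fun p : X × ℝ≥0 => (f p.2 : ℝ≥0∞)) C
    _ ≤ ∑' i, (hausdorffPre f ρ (s i) + ε' i) := ENNReal.tsum_le_tsum fun i => (hCsum i).le
    _ = ∑' i, hausdorffPre f ρ (s i) + ∑' i, (ε' i : ℝ≥0∞) := ENNReal.tsum_add
    _ ≤ _ := by gcongr

/-- `hausdorffMeas f` as an outer measure. -/
noncomputable def hausdorffOuter (X : Type*) [MetricSpace X] (f : ℝ≥0 → ℝ≥0) :
    OuterMeasure X where
  measureOf := hausdorffMeas f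
  empty := by simp [hausdorffMeas, hausdorffPre_empty]
  mono h := iSup₂_mono fun ρ _ => hausdorffPre_mono f ρ h
  iUnion_nat s _ := iSup₂_le fun ρ hρ => (hausdorffPre_iUnion_le f ρ s).trans <|
    ENNReal.tsum_le_tsum fun i => hausdorffPre_le_hausdorffMeas f hρ (s i)

theorem hausdorffOuter_apply (f : ℝ≥0 → ℝ≥0) (E : Set X) :
    hausdorffOuter X f E = hausdorffMeas f E := rfl

theorem hausdorffMeas_mono (f : ℝ≥0 → ℝ≥0) {E E' : Set X} (h : E ⊆ E') :
    hausdorffMeas f E ≤ hausdorffMeas f E' :=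
  measure_mono (μ := hausdorffOuter X f) h

/-- Two points of a ball of radius below `ρ` are less than `2 * ρ` apart, so no ball of a cover
meets both sets and the cover splits into two disjoint families. -/
theorem hausdorffPre_add_le (f : ℝ≥0 → ℝ≥0) {ρ r : ℝ≥0} (hρ : 2 * ρ ≤ r) {s t : Set X}
    (hst : ∀ x ∈ s, ∀ y ∈ t, (r : ℝ) ≤ dist x y) :
    hausdorffPre f ρ s + hausdorffPre f ρ t ≤ hausdorffPre f ρ (s ∪ t) := by
  refine le_iInf₂ fun C hC => ?_
  let D (E : Set X) : Set (X × ℝ≥0) := {p ∈ C | (Metric.ball p.1 (p.2 : ℝ) ∩ E).Nonempty}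
  have hD : ∀ E ⊆ s ∪ t, hausdorffPre f ρ E ≤ ∑' p : D E, (f p.1.2 : ℝ≥0∞) := by
    intro E hE
    refine hausdorffPre_le_tsum f ⟨hC.1.mono (sep_subset _ _), fun p hp => hC.2.1 p hp.1, ?_⟩
    intro x hx
    obtain ⟨p, hp, hxp⟩ := mem_iUnion₂.1 (hC.2.2 (hE hx))
    exact mem_iUnion₂.2 ⟨p, ⟨hp, x, hxp, hx⟩, hxp⟩
  have hdisj : Disjoint (D s) (D t) := by
    refine Set.disjoint_left.2 ?_
    rintro p ⟨hp, x, hx, hxs⟩ ⟨-, y, hy, hyt⟩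
    have h1 := hst x hxs y hyt
    have h2 := dist_triangle_right x y p.1
    have h3 : (p.2 : ℝ) < ρ := hC.2.1 p hp
    have h4 : 2 * (ρ : ℝ) ≤ r := by exact_mod_cast hρ
    rw [Metric.mem_ball] at hx hy
    linarith
  calc hausdorffPre f ρ s + hausdorffPre f ρ t
      ≤ ∑' p : D s, (f p.1.2 : ℝ≥0∞) + ∑' p : D t, (f p.1.2 : ℝ≥0∞) :=
        add_le_add (hD s subset_union_left) (hD t subset_union_right)
    _ = ∑' p : (D s ∪ D t : Set _), (f p.1.2 : ℝ≥0∞) :=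
        (ENNReal.summable.tsum_union_disjoint (f := fun p : X × ℝ≥0 => (f p.2 : ℝ≥0∞))
          hdisj ENNReal.summable).symm
    _ ≤ ∑' p : C, (f p.1.2 : ℝ≥0∞) :=
        ENNReal.tsum_mono_subtype (fun p : X × ℝ≥0 => (f p.2 : ℝ≥0∞))
          (union_subset (sep_subset _ _) (sep_subset _ _))

theorem isMetric_hausdorffOuter (f : ℝ≥0 → ℝ≥0) : (hausdorffOuter X f).IsMetric := by
  rintro s t ⟨r, hr0, hr⟩
  refine le_antisymm (measure_union_le s t) ?_
  simp only [hausdorffOuter_apply]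
  obtain ⟨r', hr'0, hr'⟩ := ENNReal.lt_iff_exists_nnreal_btwn.1 (pos_iff_ne_zero.2 hr0)
  have hr'0 : 0 < r' := by exact_mod_cast hr'0
  have hst : ∀ x ∈ s, ∀ y ∈ t, (r' : ℝ) ≤ dist x y := by
    intro x hx y hy
    have := hr'.le.trans (hr x hx y hy)
    rw [edist_nndist] at this
    exact_mod_cast this
  refine ENNReal.biSup_add_biSup_le' (p := fun ρ : ℝ≥0 => 0 < ρ) (q := fun ρ : ℝ≥0 => 0 < ρ)
    ⟨1, one_pos⟩ ⟨1, one_pos⟩ fun ρ₁ h₁ ρ₂ h₂ => ?_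
  let ρ := min (r' / 2) (min ρ₁ ρ₂)
  have hρ : 0 < ρ := lt_min (half_pos hr'0) (lt_min h₁ h₂)
  have hle : 2 * ρ ≤ r' := by
    calc 2 * ρ ≤ 2 * (r' / 2) := by gcongr; exact min_le_left _ _
      _ = r' := by field_simp
  exact (add_le_add (hausdorffPre_anti f ((min_le_right _ _).trans (min_le_left _ _)) s)
    (hausdorffPre_anti f ((min_le_right _ _).trans (min_le_right _ _)) t)).trans
    ((hausdorffPre_add_le f hle hst).trans (hausdorffPre_le_hausdorffMeas f hρ _))

/-- `hausdorffMeas f` as a Borel measure. -/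
noncomputable def hausdorffMeasure (X : Type*) [MetricSpace X] [MeasurableSpace X] [BorelSpace X]
    (f : ℝ≥0 → ℝ≥0) : Measure X :=
  (hausdorffOuter X f).toMeasure <|
    (BorelSpace.measurable_eq (α := X)).trans_le (isMetric_hausdorffOuter f).borel_le_caratheodory

theorem hausdorffMeasure_apply [MeasurableSpace X] [BorelSpace X] (f : ℝ≥0 → ℝ≥0) {E : Set X}
    (hE : MeasurableSet E) : hausdorffMeasure X f E = hausdorffMeas f E :=
  toMeasure_apply _ _ hE

theorem hausdorffMeas_le_mul {f g : ℝ≥0 → ℝ≥0} {K ρ : ℝ≥0} (hK : K ≠ 0) (hρ : 0 < ρ)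
    (h : ∀ r < ρ, f r ≤ K * g r) (E : Set X) :
    hausdorffMeas f E ≤ K * hausdorffMeas g E := by
  refine iSup₂_le fun ρ' hρ' => ?_
  have hm : 0 < min ρ ρ' := lt_min hρ hρ'
  refine (hausdorffPre_anti f (min_le_right ρ ρ') E).trans ?_
  refine le_trans ?_ (mul_le_mul_right (hausdorffPre_le_hausdorffMeas g hm E) _)
  have hK' : (K : ℝ≥0∞) ≠ 0 := ENNReal.coe_ne_zero.2 hK
  rw [hausdorffPre, hausdorffPre, ENNReal.mul_iInf_of_ne hK' ENNReal.coe_ne_top]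
  refine iInf_mono fun C => ?_
  rw [ENNReal.mul_iInf_of_ne hK' ENNReal.coe_ne_top]
  refine iInf_mono fun hC => ?_
  rw [← ENNReal.tsum_mul_left]
  refine ENNReal.tsum_le_tsum fun p => ?_
  exact_mod_cast h _ ((hC.2.1 _ p.2).trans_le (min_le_left _ _))

end OuterMeasure

/-- The Hausdorff `g`-measure of a ball of radius `r < r₀` lies between `c₁ * g r` and `c₂ * g r`,
for a non-decreasing doubling `g` that vanishes only at `0`. -/
structure RegularGauge (X : Type*) [MetricSpace X] (g : ℝ≥0 → ℝ≥0) (lam c₁ c₂ r₀ : ℝ≥0) :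
    Prop where
  zero : g 0 = 0
  pos : ∀ r, 0 < r → 0 < g r
  mono : Monotone g
  doubling : ∀ r, g (2 * r) ≤ lam * g r
  one_le_lam : 1 ≤ lam
  c₁_pos : 0 < c₁
  c₂_pos : 0 < c₂
  r₀_pos : 0 < r₀
  lower : ∀ (x : X) (r : ℝ≥0), 0 < r → r < r₀ →
    ((c₁ * g r : ℝ≥0) : ℝ≥0∞) ≤ hausdorffMeas g (Metric.ball x (r : ℝ))
  upper : ∀ (x : X) (r : ℝ≥0), 0 < r → r < r₀ →
    hausdorffMeas g (Metric.ball x (r : ℝ)) ≤ ((c₂ * g r : ℝ≥0) : ℝ≥0∞)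

theorem IsDimensionFunction.map_zero {f : ℝ≥0 → ℝ≥0} (hf : IsDimensionFunction f) : f 0 = 0 := by
  refine le_antisymm (ge_of_tendsto hf.tendsto_zero ?_) bot_le
  filter_upwards [self_mem_nhdsWithin] with r _ using hf.mono bot_le

theorem IsDimensionFunction.exists_forall_lt {f : ℝ≥0 → ℝ≥0} (hf : IsDimensionFunction f)
    {a : ℝ≥0} (ha : 0 < a) : ∃ r, 0 < r ∧ f r < a := by
  have h := (hf.tendsto_zero.eventually (gt_mem_nhds ha)).and self_mem_nhdsWithin
  obtain ⟨r, h1, h2⟩ := h.exists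
  exact ⟨r, h2, h1⟩

theorem exists_regularGauge {X : Type*} [MetricSpace X] {g : ℝ≥0 → ℝ≥0}
    (hg : IsDimensionFunction g) (hgd : IsDoubling g) (hgb : BallMeasureComparable X g) :
    ∃ lam c₁ c₂ r₀, RegularGauge X g lam c₁ c₂ r₀ := by
  obtain ⟨lam, hlam, hd⟩ := hgd
  obtain ⟨c₁, c₂, r₀, h1, -, h2, h0, h⟩ := hgb
  refine ⟨lam, c₁, c₂, r₀, hg.map_zero, fun r hr => ?_, hg.mono, fun r => ?_, hlam.le, h1,
    one_pos.trans h2, h0, fun x r hr hr' => (h x r hr hr').1, fun x r hr hr' => (h x r hr hr').2⟩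
  · exact pos_of_mul_pos_right ((zero_le).trans_lt (hd r hr)) zero_le
  · rcases eq_or_ne r 0 with rfl | hr
    · simp [hg.map_zero]
    · exact (hd r (pos_iff_ne_zero.2 hr)).le

/-! ### Doubling estimates and the Vitali density lemma. -/

namespace RegularGauge

variable {X : Type*} [MetricSpace X] {g : ℝ≥0 → ℝ≥0} {lam c₁ c₂ r₀ : ℝ≥0}

theorem map_four_mul_le (G : RegularGauge X g lam c₁ c₂ r₀) (r : ℝ≥0) :
    g (4 * r) ≤ lam ^ 2 * g r := by
  calc g (4 * r) = g (2 * (2 * r)) := by ring_nf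
    _ ≤ lam * (lam * g r) := (G.doubling _).trans (by gcongr; exact G.doubling r)
    _ = _ := by ring

theorem map_eight_mul_le (G : RegularGauge X g lam c₁ c₂ r₀) (r : ℝ≥0) :
    g (8 * r) ≤ lam ^ 3 * g r := by
  calc g (8 * r) = g (2 * (4 * r)) := by ring_nf
    _ ≤ lam * (lam ^ 2 * g r) := (G.doubling _).trans (by gcongr; exact G.map_four_mul_le r)
    _ = _ := by ring

theorem upper_of_lt (G : RegularGauge X g lam c₁ c₂ r₀) (x : X) {r : ℝ≥0} (hr : r < r₀) :
    hausdorffMeas g (Metric.ball x (r : ℝ)) ≤ ((c₂ * g r : ℝ≥0) : ℝ≥0∞) := by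
  rcases eq_or_ne r 0 with rfl | h
  · have h : hausdorffMeas g (∅ : Set X) = 0 := (hausdorffOuter X g).empty
    simp [h]
  · exact G.upper x r (pos_iff_ne_zero.2 h) hr

/-- Vitali's lemma selects disjoint balls of large `θ`-mass whose fivefold enlargements cover `S`.
The factor `8` exceeds `5`, which allows open balls, and costs three doublings, whence `lam ^ 3`. -/
theorem hausdorffMeas_le_of_density [MeasurableSpace X] [BorelSpace X]
    (G : RegularGauge X g lam c₁ c₂ r₀) (θ : Measure X) {S : Set X} {c : ℝ≥0} (hc : 0 < c)
    (hS : ∀ x ∈ S, ∀ ε : ℝ≥0, 0 < ε → ∃ r : ℝ≥0, 0 < r ∧ r < ε ∧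
      ((c * g r : ℝ≥0) : ℝ≥0∞) ≤ θ (Metric.closedBall x r)) :
    hausdorffMeas g S ≤ (c₂ * lam ^ 3 / c : ℝ≥0) * θ univ := by
  have h8 : 0 < r₀ / 8 := by have := G.r₀_pos; positivity
  choose! r hr0 hr8 hr using fun x hx => hS x hx (r₀ / 8) h8
  obtain ⟨u, hut, hdisj, hcov⟩ := Vitali.exists_disjoint_subfamily_covering_enlargement_closedBall
    S (fun x => x) (fun x => (r x : ℝ)) (r₀ / 8 : ℝ≥0) (fun x hx => by exact_mod_cast (hr8 x hx).le)
    5 (by norm_num)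
  have hsumθ : ∑' x : u, θ (Metric.closedBall x.1 (r x.1)) ≤ θ univ := by
    refine (tsum_meas_le_meas_iUnion_of_disjoint θ (fun x : u => measurableSet_closedBall) ?_).trans
      (measure_mono (subset_univ _))
    exact fun x y hxy => hdisj x.2 y.2 (fun h => hxy (Subtype.ext h))
  rcases eq_or_ne (θ univ) ⊤ with htop | htop
  · rw [htop, ENNReal.mul_top]
    · exact le_top
    · have h1 := G.c₂_pos
      have h2 := one_pos.trans_le G.one_le_lam
      exact ENNReal.coe_ne_zero.2 (by positivity)
  -- Separability is not assumed: the selected balls are countably many because their `θ`-masses are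
  -- positive with finite sum.
  have hcount : Countable u := by
    have := Summable.countable_support_ennreal (ne_top_of_le_ne_top htop hsumθ)
    rw [← countable_univ_iff]
    refine this.mono fun x _ => ?_
    have h1 : (0 : ℝ≥0∞) < ((c * g (r x.1) : ℝ≥0) : ℝ≥0∞) := by
      exact_mod_cast mul_pos hc (G.pos _ (hr0 _ (hut x.2)))
    exact (h1.trans_le (hr _ (hut x.2))).ne'
  have hsub : S ⊆ ⋃ x : u, Metric.ball x.1 ((8 * r x.1 : ℝ≥0) : ℝ) := by
    intro x hx
    obtain ⟨b, hb, hxb⟩ := hcov x hx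
    refine mem_iUnion.2 ⟨⟨b, hb⟩, ?_⟩
    have h1 := hxb (Metric.mem_closedBall_self (r x).2)
    have h2 : (0 : ℝ) < r b := hr0 b (hut hb)
    rw [Metric.mem_closedBall] at h1
    rw [Metric.mem_ball]
    push_cast
    linarith
  calc hausdorffMeas g S ≤ hausdorffOuter X g (⋃ x : u, Metric.ball x.1 ((8 * r x.1 : ℝ≥0) : ℝ)) :=
        hausdorffMeas_mono g hsub
    _ ≤ ∑' x : u, hausdorffMeas g (Metric.ball x.1 ((8 * r x.1 : ℝ≥0) : ℝ)) := measure_iUnion_le _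
    _ ≤ ∑' x : u, ((c₂ * lam ^ 3 / c : ℝ≥0) : ℝ≥0∞) * θ (Metric.closedBall x.1 (r x.1)) := by
        refine ENNReal.tsum_le_tsum fun x => ?_
        have h8 : 8 * r x.1 < r₀ := by
          have := hr8 _ (hut x.2)
          rw [lt_div_iff₀ (by norm_num)] at this
          rwa [mul_comm]
        refine (G.upper_of_lt x.1 h8).trans ?_
        calc ((c₂ * g (8 * r x.1) : ℝ≥0) : ℝ≥0∞)
            ≤ ((c₂ * lam ^ 3 / c * (c * g (r x.1)) : ℝ≥0) : ℝ≥0∞) := by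
              refine ENNReal.coe_le_coe.2 ?_
              calc c₂ * g (8 * r x.1) ≤ c₂ * (lam ^ 3 * g (r x.1)) := by
                    gcongr; exact G.map_eight_mul_le _
                _ = _ := by field_simp
          _ ≤ _ := by
              rw [ENNReal.coe_mul]
              gcongr
              exact hr _ (hut x.2)
    _ = _ := ENNReal.tsum_mul_left
    _ ≤ _ := by gcongr

end RegularGauge

end MTP

/-! ### The generalised inverse and limsup sets. -/

namespace MTP

theorem le_genInv {g : ℝ≥0 → ℝ≥0} (hg : Monotone g) {y r t : ℝ≥0} (hr : g r ≤ y) (ht : y < g t) :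
    r ≤ genInv g y :=
  le_csSup ⟨t, fun _ hs => (hg.reflect_lt (lt_of_le_of_lt hs ht)).le⟩ hr

theorem genInv_le {g : ℝ≥0 → ℝ≥0} (hg : Monotone g) {y t : ℝ≥0} (ht : y < g t) :
    genInv g y ≤ t :=
  csSup_le' fun _ hs => (hg.reflect_lt (lt_of_le_of_lt hs ht)).le

/-- Left continuity carries the bound to the supremum. An unbounded set has supremum `0` by
convention, where the bound holds since `g 0 = 0`. -/
theorem map_genInv_le {g : ℝ≥0 → ℝ≥0} (hg : IsDimensionFunction g) (y : ℝ≥0) :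
    g (genInv g y) ≤ y := by
  rcases eq_or_ne (genInv g y) 0 with h0 | h0
  · rw [h0, hg.map_zero]; exact zero_le
  · have : (𝓝[<] genInv g y).NeBot := nhdsLT_neBot_of_exists_lt ⟨0, pos_iff_ne_zero.2 h0⟩
    refine le_of_tendsto (hg.leftCts (genInv g y)) ?_
    filter_upwards [self_mem_nhdsWithin] with r hr
    have hne : {s : ℝ≥0 | g s ≤ y}.Nonempty := ⟨0, by simp [hg.map_zero]⟩
    obtain ⟨s, hs, hrs⟩ := exists_lt_of_lt_csSup hne hr
    exact (hg.mono hrs.le).trans hs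

section Limsup

variable {X : Type*} [MetricSpace X]

theorem isOpen_nbhd (F : Set X) (δ : ℝ≥0) : IsOpen (nbhd F δ) := Metric.isOpen_thickening

theorem nbhd_mono (F : Set X) {δ δ' : ℝ≥0} (h : δ ≤ δ') : nbhd F δ ⊆ nbhd F δ' :=
  Metric.thickening_mono (by exact_mod_cast h) F

theorem mem_nbhd_iff {F : Set X} {δ : ℝ≥0} {x : X} : x ∈ nbhd F δ ↔ ∃ y ∈ F, dist x y < δ :=
  Metric.mem_thickening_iff

theorem mem_limsupSet_iff {F : ℕ → Set X} {Υ : ℕ → ℝ≥0} {x : X} :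
    x ∈ limsupSet F Υ ↔ ∃ᶠ j in atTop, x ∈ nbhd (F j) (Υ j) :=
  Nat.frequently_atTop_iff_infinite.symm

theorem limsupSet_eq (F : ℕ → Set X) (Υ : ℕ → ℝ≥0) :
    limsupSet F Υ = ⋂ n, ⋃ j, ⋃ (_ : n ≤ j), nbhd (F j) (Υ j) := by
  ext x
  simp [mem_limsupSet_iff, frequently_atTop]

theorem measurableSet_limsupSet [MeasurableSpace X] [BorelSpace X] (F : ℕ → Set X)
    (Υ : ℕ → ℝ≥0) : MeasurableSet (limsupSet F Υ) := by
  rw [limsupSet_eq]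
  exact .iInter fun n => .iUnion fun j => .iUnion fun _ => (isOpen_nbhd _ _).measurableSet

end Limsup

/-! ### Density arguments, and the case of bounded `f / g`. -/

namespace RegularGauge

variable {X : Type*} [MetricSpace X] {g : ℝ≥0 → ℝ≥0} {lam c₁ c₂ r₀ : ℝ≥0}

/-- A finite purely atomic measure has zero upper density at almost every point. -/
theorem hausdorffMeas_upperDensity_eq_zero [MeasurableSpace X] [BorelSpace X]
    (G : RegularGauge X g lam c₁ c₂ r₀) {C : Set (X × ℝ≥0)} {w : X × ℝ≥0 → ℝ≥0∞}
    (hw : ∑' p : C, w p ≠ ⊤) {c : ℝ≥0} (hc : 0 < c) :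
    hausdorffMeas g {x | (∀ p ∈ C, p.1 ≠ x) ∧ ∀ ε : ℝ≥0, 0 < ε → ∃ r : ℝ≥0, 0 < r ∧ r < ε ∧
      ((c * g r : ℝ≥0) : ℝ≥0∞) ≤ ∑' p : {p ∈ C | dist p.1 x ≤ r}, w p} = 0 := by
  set S := {x | (∀ p ∈ C, p.1 ≠ x) ∧ ∀ ε : ℝ≥0, 0 < ε → ∃ r : ℝ≥0, 0 < r ∧ r < ε ∧
      ((c * g r : ℝ≥0) : ℝ≥0∞) ≤ ∑' p : {p ∈ C | dist p.1 x ≤ r}, w p}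
  -- No atom sits at a point of `S`, so small balls around it miss any finite set `T` of atoms. The
  -- density lemma thus applies with only the tail outside `T`, whose mass tends to `0`.
  have key : ∀ T : Finset C, hausdorffMeas g S ≤
      (c₂ * lam ^ 3 / c : ℝ≥0) * ∑' p : {p // p ∉ T}, w p.1 := by
    intro T
    let θ : Measure X := Measure.sum fun p : {p // p ∉ T} => w p.1 • Measure.dirac p.1.1.1
    have hθ : θ univ = ∑' p : {p // p ∉ T}, w p.1 := by
      simp [θ, Measure.sum_apply]
    rw [← hθ]
    refine G.hausdorffMeas_le_of_density θ hc fun x hx ε hε => ?_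
    obtain ⟨η, hη, hηT⟩ : ∃ η : ℝ≥0, 0 < η ∧ ∀ p ∈ T, η < nndist p.1.1 x := by
      rcases T.eq_empty_or_nonempty with rfl | hne
      · exact ⟨1, one_pos, by simp⟩
      · obtain ⟨p, hp, hmin⟩ := T.exists_min_image (fun p => nndist p.1.1 x) hne
        have h0 : 0 < nndist p.1.1 x := by
          rw [pos_iff_ne_zero, Ne, nndist_eq_zero]
          exact hx.1 p.1 p.2
        exact ⟨nndist p.1.1 x / 2, half_pos h0, fun q hq =>
          (NNReal.half_lt_self h0.ne').trans_le (hmin q hq)⟩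
    obtain ⟨r, hr0, hr, hle⟩ := hx.2 (min ε η) (lt_min hε hη)
    refine ⟨r, hr0, hr.trans_le (min_le_left _ _), hle.trans ?_⟩
    rw [Measure.sum_apply _ Metric.isClosed_closedBall.measurableSet]
    have hnot : ∀ p : {p ∈ C | dist p.1 x ≤ r}, (⟨p.1, p.2.1⟩ : C) ∉ T := by
      rintro ⟨p, hpC, hpx⟩ hT
      have h1 : η < nndist p.1 x := hηT _ hT
      have h2 : nndist p.1 x ≤ r := by exact_mod_cast hpx
      exact absurd (h2.trans_lt (hr.trans_le (min_le_right _ _))) h1.le.not_gt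
    let i : {p ∈ C | dist p.1 x ≤ r} → {p : C // p ∉ T} := fun p => ⟨⟨p.1, p.2.1⟩, hnot p⟩
    have hi : Function.Injective i := fun p q h => Subtype.ext (congrArg (fun s => s.1.1) h)
    refine le_trans (le_of_eq ?_) (ENNReal.tsum_comp_le_tsum_of_injective hi _)
    refine tsum_congr fun p => ?_
    have hmem : p.1.1 ∈ Metric.closedBall x (r : ℝ) := p.2.2
    simp [i, Measure.dirac_apply' _ Metric.isClosed_closedBall.measurableSet, hmem]
  have hlim := ENNReal.Tendsto.const_mul (a := ((c₂ * lam ^ 3 / c : ℝ≥0) : ℝ≥0∞))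
    (ENNReal.tendsto_tsum_compl_atTop_zero hw) (Or.inr ENNReal.coe_ne_top)
  rw [mul_zero] at hlim
  exact le_antisymm (ge_of_tendsto' hlim key) bot_le

/-- Shrinking the neighbourhoods in a limsup set of full measure, in such a way that the gauge of
the radii stays comparable, does not change the measure. -/
theorem hausdorffMeas_ball_diff_limsupSet [MeasurableSpace X] [BorelSpace X]
    (G : RegularGauge X g lam c₁ c₂ r₀) {F : ℕ → Set X} {Υ Υ' : ℕ → ℝ≥0}
    (hΥ' : Tendsto Υ' atTop (𝓝 0)) {K : ℝ≥0} (hK : 0 < K)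
    (h : ∀ᶠ j in atTop, g (Υ' j) ≤ K * g (Υ j)) {z : X} {R : ℝ≥0} (hR : R < r₀)
    (h0 : hausdorffMeas g (Metric.ball z (R : ℝ) \ limsupSet F Υ') = 0) :
    hausdorffMeas g (Metric.ball z (R : ℝ) \ limsupSet F Υ) = 0 := by
  set B := Metric.ball z (R : ℝ)
  have hBopen : IsOpen B := Metric.isOpen_ball
  have hlam := one_pos.trans_le G.one_le_lam
  have hfin : IsFiniteMeasure ((hausdorffMeasure X g).restrict B) := by
    refine ⟨?_⟩
    rw [Measure.restrict_apply_univ, hausdorffMeasure_apply _ hBopen.measurableSet]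
    exact (G.upper_of_lt z hR).trans_lt ENNReal.coe_lt_top
  have key : ∀ n, hausdorffMeas g
      ((B \ ⋃ j, ⋃ (_ : n ≤ j), nbhd (F j) (Υ j)) ∩ limsupSet F Υ') = 0 := by
    intro n
    set N := B \ ⋃ j, ⋃ (_ : n ≤ j), nbhd (F j) (Υ j)
    have hNmeas : MeasurableSet N := hBopen.measurableSet.diff
      (.iUnion fun j => .iUnion fun _ => (isOpen_nbhd _ _).measurableSet)
    let c : ℝ≥0 := c₁ / (K * lam)
    have hc : 0 < c := div_pos G.c₁_pos (mul_pos hK hlam)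
    -- Outer regularity gives an open `V ⊇ N` with little mass in `V \ N`. Near a point of `N` in
    -- the larger neighbourhood of `F j`, the ball of radius `Υ j` about a point of `F j` lies in `V
    -- \ N` and fills a fixed proportion of the ball of radius `2 * Υ' j`.
    have bound : ∀ η : ℝ≥0, 0 < η → hausdorffMeas g (N ∩ limsupSet F Υ') ≤
        ((c₂ * lam ^ 3 / c * η : ℝ≥0) : ℝ≥0∞) := by
      intro η hη
      obtain ⟨V, hNV, hVopen, -, hV⟩ := hNmeas.exists_isOpen_sdiff_lt
        (μ := (hausdorffMeasure X g).restrict B) (measure_ne_top _ _)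
        (ENNReal.coe_ne_zero.2 hη.ne')
      rw [Measure.restrict_apply (hVopen.measurableSet.diff hNmeas)] at hV
      have hVB : IsOpen (V ∩ B) := hVopen.inter hBopen
      refine (G.hausdorffMeas_le_of_density
        ((hausdorffMeasure X g).restrict ((V \ N) ∩ B)) hc fun x hx ε hε => ?_).trans ?_
      · obtain ⟨ε', hε', hball⟩ := Metric.isOpen_iff.1 hVB x ⟨hNV hx.1, hx.1.1⟩
        lift ε' to ℝ≥0 using hε'.le
        have hε' : 0 < ε' := by exact_mod_cast hε'
        let t := min r₀ (min ε ε') / 2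
        have ht : 0 < t := half_pos (lt_min G.r₀_pos (lt_min hε hε'))
        obtain ⟨j, hxj, hnj, hgj, htj⟩ := ((mem_limsupSet_iff.1 hx.2).and_eventually
          ((eventually_ge_atTop n).and (h.and (hΥ'.eventually (gt_mem_nhds ht))))).exists
        obtain ⟨y, hyF, hxy⟩ := mem_nbhd_iff.1 hxj
        have hlt : Υ j < Υ' j := by
          by_contra! hle
          exact hx.1.2 (mem_iUnion₂.2 ⟨j, hnj, nbhd_mono _ hle hxj⟩)
        have hΥ'pos : 0 < Υ' j := zero_le.trans_lt hlt
        have hΥpos : 0 < Υ j := by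
          refine pos_iff_ne_zero.2 fun h0 => ?_
          rw [h0, G.zero, mul_zero] at hgj
          exact (G.pos _ hΥ'pos).not_ge hgj
        have h2 : 2 * Υ' j < min r₀ (min ε ε') := by
          have := (lt_div_iff₀ (by norm_num : (0 : ℝ≥0) < 2)).1 htj
          rwa [mul_comm]
        have hr0 := h2.trans_le (min_le_left _ _)
        have hrε := h2.trans_le ((min_le_right _ _).trans (min_le_left _ _))
        have hrε' := h2.trans_le ((min_le_right _ _).trans (min_le_right _ _))
        refine ⟨2 * Υ' j, by positivity, hrε, ?_⟩
        have hsub : Metric.ball y (Υ j : ℝ) ⊆ Metric.closedBall x ((2 * Υ' j : ℝ≥0) : ℝ) := by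
          intro v hv
          have h1 : (Υ j : ℝ) < Υ' j := by exact_mod_cast hlt
          have h3 := dist_triangle v y x
          rw [Metric.mem_ball] at hv
          rw [Metric.mem_closedBall]
          rw [dist_comm] at hxy
          push_cast
          linarith
        have hsub2 : Metric.ball y (Υ j : ℝ) ⊆ (V \ N) ∩ B := by
          intro v hv
          have h1 : v ∈ V ∩ B := hball <| Metric.closedBall_subset_ball
            (by exact_mod_cast hrε') (hsub hv)
          refine ⟨⟨h1.1, fun hvN => hvN.2 (mem_iUnion₂.2 ⟨j, hnj, ?_⟩)⟩, h1.2⟩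
          exact mem_nbhd_iff.2 ⟨y, hyF, hv⟩
        calc ((c * g (2 * Υ' j) : ℝ≥0) : ℝ≥0∞) ≤ ((c₁ * g (Υ j) : ℝ≥0) : ℝ≥0∞) := by
              refine ENNReal.coe_le_coe.2 ?_
              calc c * g (2 * Υ' j) ≤ c * (lam * (K * g (Υ j))) := by
                    gcongr; exact (G.doubling _).trans (by gcongr)
                _ = _ := by simp only [c]; field_simp
          _ ≤ hausdorffMeas g (Metric.ball y (Υ j : ℝ)) := by
              refine G.lower y _ hΥpos ((hlt.trans_le ?_).trans hr0)
              exact le_mul_of_one_le_left zero_le one_le_two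
          _ = hausdorffMeasure X g (Metric.ball y (Υ j : ℝ)) :=
              (hausdorffMeasure_apply _ Metric.isOpen_ball.measurableSet).symm
          _ ≤ hausdorffMeasure X g
                (Metric.closedBall x ((2 * Υ' j : ℝ≥0) : ℝ) ∩ ((V \ N) ∩ B)) :=
              measure_mono (subset_inter hsub hsub2)
          _ = _ := (Measure.restrict_apply Metric.isClosed_closedBall.measurableSet).symm
      · rw [Measure.restrict_apply_univ, ENNReal.coe_mul]
        gcongr
    refine le_antisymm (ENNReal.le_of_forall_pos_le_add fun η hη _ => ?_) bot_le
    have hk : 0 < c₂ * lam ^ 3 / c := by have := G.c₂_pos; positivity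
    refine (bound (η / (c₂ * lam ^ 3 / c)) (div_pos hη hk)).trans ?_
    rw [mul_div_cancel₀ _ hk.ne', zero_add]
  refine measure_mono_null (μ := hausdorffOuter X g) (t := (B \ limsupSet F Υ') ∪ ⋃ n,
    ((B \ ⋃ j, ⋃ (_ : n ≤ j), nbhd (F j) (Υ j)) ∩ limsupSet F Υ')) ?_
    (measure_union_null h0 (measure_iUnion_null key))
  rintro x ⟨hxB, hx⟩
  by_cases hx' : x ∈ limsupSet F Υ'
  · right
    rw [limsupSet_eq, mem_iInter, not_forall] at hx
    obtain ⟨n, hn⟩ := hx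
    exact mem_iUnion.2 ⟨n, ⟨hxB, hn⟩, hx'⟩
  · exact Or.inl ⟨hxB, hx'⟩

/-- If `f ≤ K * g` near zero, then a set of full `g`-measure in all small balls has full
`f`-measure in all balls. -/
theorem hausdorffMeas_ball_inter_eq (G : RegularGauge X g lam c₁ c₂ r₀) {f : ℝ≥0 → ℝ≥0}
    {K ρ : ℝ≥0} (hK : K ≠ 0) (hρ : 0 < ρ) (h : ∀ r < ρ, f r ≤ K * g r) {A : Set X} {t : ℝ≥0}
    (ht : 0 < t)
    (hA : ∀ (x : X) (r : ℝ≥0), 0 < r → r < t → hausdorffMeas g (Metric.ball x (r : ℝ) \ A) = 0)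
    (x : X) (r : ℝ) :
    hausdorffMeas f (Metric.ball x r ∩ A) = hausdorffMeas f (Metric.ball x r) := by
  refine le_antisymm (hausdorffMeas_mono f inter_subset_left) ?_
  rcases eq_or_ne (hausdorffMeas f (Metric.ball x r ∩ A)) ⊤ with htop | htop
  · rw [htop]; exact le_top
  have hA' : ∀ (y : X) (s : ℝ≥0), 0 < s → s < t →
      hausdorffMeas f (Metric.ball y (s : ℝ) \ A) = 0 := by
    intro y s hs hst
    refine le_antisymm ((hausdorffMeas_le_mul hK hρ h _).trans ?_) bot_le
    rw [hA y s hs hst, mul_zero]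
  -- `A` is dense in the ball, as small balls have positive `g`-measure.
  have hdense : ∀ y ∈ Metric.ball x r, ∀ s : ℝ≥0, 0 < s →
      ∃ a ∈ Metric.ball x r ∩ A, dist y a < s := by
    intro y hy s hs
    obtain ⟨ε, hε, hball⟩ := Metric.isOpen_iff.1 Metric.isOpen_ball y hy
    lift ε to ℝ≥0 using hε.le
    have hε : 0 < ε := by exact_mod_cast hε
    set s' := min (min s ε) (min t r₀) / 2
    have hm : 0 < min (min s ε) (min t r₀) := lt_min (lt_min hs hε) (lt_min ht G.r₀_pos)
    have hs'0 : 0 < s' := half_pos hm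
    have hs'lt : s' < min (min s ε) (min t r₀) := NNReal.half_lt_self hm.ne'
    have h1 : s' < s := hs'lt.trans_le ((min_le_left _ _).trans (min_le_left _ _))
    have h2 : s' < ε := hs'lt.trans_le ((min_le_left _ _).trans (min_le_right _ _))
    have h3 : s' < t := hs'lt.trans_le ((min_le_right _ _).trans (min_le_left _ _))
    have h4 : s' < r₀ := hs'lt.trans_le ((min_le_right _ _).trans (min_le_right _ _))
    by_contra! hno
    have hsub : Metric.ball y (s' : ℝ) ⊆ Metric.ball y (s' : ℝ) \ A := by
      refine fun a ha => ⟨ha, fun haA => ?_⟩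
      have h5 := hno a ⟨hball (Metric.ball_subset_ball (by exact_mod_cast h2.le) ha), haA⟩
      rw [Metric.mem_ball, dist_comm] at ha
      exact absurd (ha.trans (by exact_mod_cast h1)) h5.not_gt
    have h6 := (G.lower y s' hs'0 h4).trans ((hausdorffMeas_mono g hsub).trans_eq
      (hA y s' hs'0 h3))
    have h7 : 0 < c₁ * g s' := mul_pos G.c₁_pos (G.pos _ hs'0)
    exact h7.not_ge (by exact_mod_cast h6)
  have ht3 : 0 < t / 3 := by positivity
  -- Finite `f`-measure supplies a countable cover of `B ∩ A` by small balls. By density, slightly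
  -- larger balls cover all of `B`, so `B \ A` is a countable union of null sets.
  obtain ⟨C, hC, -⟩ := exists_cover_of_hausdorffPre_lt
    ((hausdorffPre_le_hausdorffMeas f ht3 _).trans_lt (lt_top_iff_ne_top.2 htop))
  have hnull : hausdorffMeas f (⋃ p ∈ C, Metric.ball p.1 ((2 * (t / 3) : ℝ≥0) : ℝ) \ A) = 0 := by
    refine (measure_biUnion_null_iff (μ := hausdorffOuter X f) hC.1).2 fun p _ => ?_
    refine hA' p.1 _ (by positivity) ?_
    rw [← NNReal.coe_lt_coe] at ht ⊢
    push_cast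
    linarith
  have hsub : Metric.ball x r ⊆ (Metric.ball x r ∩ A) ∪
      ⋃ p ∈ C, Metric.ball p.1 ((2 * (t / 3) : ℝ≥0) : ℝ) \ A := by
    intro y hy
    by_cases hyA : y ∈ A
    · exact Or.inl ⟨hy, hyA⟩
    right
    obtain ⟨a, ha, hya⟩ := hdense y hy (t / 3) ht3
    obtain ⟨p, hp, hap⟩ := mem_iUnion₂.1 (hC.2.2 ha)
    refine mem_iUnion₂.2 ⟨p, hp, ?_, hyA⟩
    have h1 : (p.2 : ℝ) < (t / 3 : ℝ≥0) := hC.2.1 p hp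
    have h2 := dist_triangle y a p.1
    rw [Metric.mem_ball] at hap ⊢
    push_cast at *
    linarith
  calc hausdorffMeas f (Metric.ball x r)
      ≤ hausdorffMeas f (Metric.ball x r ∩ A) +
        hausdorffMeas f (⋃ p ∈ C, Metric.ball p.1 ((2 * (t / 3) : ℝ≥0) : ℝ) \ A) :=
        (hausdorffMeas_mono f hsub).trans (measure_union_le (μ := hausdorffOuter X f) _ _)
    _ = _ := by rw [hnull, add_zero]

end RegularGauge

end MTP

/-! ### The inductive step for unbounded `f / g`. -/

namespace MTP

variable {X : Type*} [MetricSpace X]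

/-- The balls of the family `C` (given as pairs of a centre and a radius) that may meet the closed
ball of radius `r` around `x`. -/
def hitting (C : Set (X × ℝ≥0)) (x : X) (r : ℝ≥0) : Set (X × ℝ≥0) :=
  {p ∈ C | dist p.1 x < p.2 + r}

namespace RegularGauge

variable {g : ℝ≥0 → ℝ≥0} {lam c₁ c₂ r₀ : ℝ≥0}

/-- Averaging over the part of a neighbourhood of `A` in a ball yields a point `y` such that the
balls of the family `I` have little `f`-mass near `y`. -/
theorem exists_point_few_hits [MeasurableSpace X] [BorelSpace X]
    (G : RegularGauge X g lam c₁ c₂ r₀) {A : Set X} {κ : ℝ} (hκ0 : 0 ≤ κ) (hκ1 : κ < 1)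
    {c₃ c₄ r₁ : ℝ≥0} (hA : ∀ r δ : ℝ≥0, 0 < r → r < r₁ → δ < r → ∀ x ∈ A,
      ((c₃ * (g δ ^ (1 - κ) * g r ^ κ) : ℝ≥0) : ℝ≥0∞) ≤
        hausdorffMeas g (Metric.ball x (r : ℝ) ∩ nbhd A δ) ∧
      hausdorffMeas g (Metric.ball x (r : ℝ) ∩ nbhd A δ) ≤
        ((c₄ * (g δ ^ (1 - κ) * g r ^ κ) : ℝ≥0) : ℝ≥0∞))
    {f : ℝ≥0 → ℝ≥0}
    (hfκ : ∀ a b, 0 < a → a ≤ b → f a * g b ^ κ ≤ f b * g a ^ κ)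
    {δ R : ℝ≥0} (hδ : 0 < δ) (hδR : δ < R) (hδr : 2 * δ < r₀) (hR : R < r₁) {x : X} (hx : x ∈ A)
    {I : Set (X × ℝ≥0)} (hI : I.Countable) (hIr : ∀ p ∈ I, 8 * p.2 < r₁) {s ε : ℝ≥0}
    (hs : ∑' p : I, (f p.1.2 : ℝ≥0∞) ≤ s)
    (hsmall : (c₂ * lam + c₄ * lam ^ 3) * s * g δ ^ κ < ε * c₃ * f δ * g R ^ κ) :
    ∃ y ∈ Metric.ball x (R : ℝ) ∩ nbhd A δ,
      ∑' p : hitting I y δ, ((min (f p.1.2) (f δ) : ℝ≥0) : ℝ≥0∞) < (ε * f δ : ℝ≥0) := by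
  by_contra! hno
  set K := c₂ * lam + c₄ * lam ^ 3
  set E := Metric.ball x (R : ℝ) ∩ nbhd A δ
  have hEopen : IsOpen E := Metric.isOpen_ball.inter (isOpen_nbhd _ _)
  have hEmeas := hEopen.measurableSet
  set μ := hausdorffMeasure X g with hμ
  have : Countable I := hI.to_subtype
  have hgδ : g δ = g δ ^ (1 - κ) * g δ ^ κ := by
    rw [← NNReal.rpow_add (G.pos _ hδ).ne']; simp
  -- If no point works, this bound holds on all of `E`; integrating it contradicts `hsmall`.
  have hpt : ∀ y, E.indicator (fun _ => ((ε * f δ : ℝ≥0) : ℝ≥0∞)) y ≤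
      ∑' p : I, (Metric.ball p.1.1 ((p.1.2 + δ : ℝ≥0) : ℝ) ∩ E).indicator
        (fun _ => ((min (f p.1.2) (f δ) : ℝ≥0) : ℝ≥0∞)) y := by
    intro y
    by_cases hy : y ∈ E
    · rw [indicator_of_mem hy]
      refine (hno y hy).trans ?_
      let i : hitting I y δ → I := fun p => ⟨p.1, p.2.1⟩
      have hi : Function.Injective i := fun p q h => Subtype.ext (congrArg (fun s => s.1) h)
      refine le_trans (le_of_eq ?_) (ENNReal.tsum_comp_le_tsum_of_injective hi _)
      refine tsum_congr fun p => ?_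
      have hmem : y ∈ Metric.ball p.1.1 ((p.1.2 + δ : ℝ≥0) : ℝ) := by
        rw [Metric.mem_ball, dist_comm]
        push_cast
        exact p.2.2
      simp only [i]
      rw [indicator_of_mem (show y ∈ Metric.ball p.1.1 ((p.1.2 + δ : ℝ≥0) : ℝ) ∩ E from ⟨hmem, hy⟩)]
    · rw [indicator_of_notMem hy]
      exact bot_le
  -- Balls smaller than `δ` are bounded by the measure of a ball of radius `2 * δ`. For larger ones
  -- the upper scaling bound applies, and monotonicity of `f / g ^ κ` trades `f δ * g ρ ^ κ` for `f
  -- ρ * g δ ^ κ`.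
  have hterm : ∀ p : I, ((min (f p.1.2) (f δ) : ℝ≥0) : ℝ≥0∞) *
      μ (Metric.ball p.1.1 ((p.1.2 + δ : ℝ≥0) : ℝ) ∩ E) ≤
      ((K * g δ : ℝ≥0) : ℝ≥0∞) * f p.1.2 := by
    rintro ⟨⟨u, ρ⟩, hp⟩
    have hmeas : MeasurableSet (Metric.ball u ((ρ + δ : ℝ≥0) : ℝ) ∩ E) :=
      Metric.isOpen_ball.measurableSet.inter hEmeas
    simp only
    rw [hμ, hausdorffMeasure_apply _ hmeas]
    rcases lt_or_ge ρ δ with hlt | hge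
    · have h1 : hausdorffMeas g (Metric.ball u ((ρ + δ : ℝ≥0) : ℝ) ∩ E) ≤
          ((c₂ * g (2 * δ) : ℝ≥0) : ℝ≥0∞) := by
        refine (hausdorffMeas_mono g (inter_subset_left.trans ?_)).trans (G.upper_of_lt u hδr)
        refine Metric.ball_subset_ball (NNReal.coe_le_coe.2 ?_)
        rw [two_mul]
        gcongr
      refine (mul_le_mul' (ENNReal.coe_le_coe.2 (min_le_left _ _)) h1).trans ?_
      rw [← ENNReal.coe_mul, ← ENNReal.coe_mul, ENNReal.coe_le_coe]
      calc f ρ * (c₂ * g (2 * δ)) ≤ f ρ * (c₂ * (lam * g δ)) := by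
            gcongr; exact G.doubling δ
        _ = (c₂ * lam) * g δ * f ρ := by ring
        _ ≤ K * g δ * f ρ := by gcongr; exact le_self_add
    · rcases (Metric.ball u ((ρ + δ : ℝ≥0) : ℝ) ∩ E).eq_empty_or_nonempty with hemp | ⟨y, hyu, hyE⟩
      · have h0 : hausdorffMeas g (∅ : Set X) = 0 := (hausdorffOuter X g).empty
        rw [hemp, h0, mul_zero]
        exact zero_le
      obtain ⟨w, hwA, hyw⟩ := mem_nbhd_iff.1 hyE.2
      have hρ : 0 < ρ := hδ.trans_le hge
      have hge' : (δ : ℝ) ≤ ρ := by exact_mod_cast hge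
      have hρ' : (0 : ℝ) < ρ := by exact_mod_cast hρ
      have hsub : Metric.ball u ((ρ + δ : ℝ≥0) : ℝ) ∩ E ⊆
          Metric.ball w ((8 * ρ : ℝ≥0) : ℝ) ∩ nbhd A δ := by
        rintro v ⟨hvu, hvE⟩
        refine ⟨?_, hvE.2⟩
        rw [Metric.mem_ball] at *
        have h1 := dist_triangle v u w
        have h2 := dist_triangle u y w
        rw [dist_comm u y] at h2
        push_cast at *
        linarith
      have h8 : δ < 8 * ρ := by
        rw [← NNReal.coe_lt_coe]; push_cast; linarith
      have h1 := (hausdorffMeas_mono g hsub).trans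
        (hA (8 * ρ) δ (by positivity) (hIr _ hp) h8 w hwA).2
      refine (mul_le_mul' (ENNReal.coe_le_coe.2 (min_le_right _ _)) h1).trans ?_
      rw [← ENNReal.coe_mul, ← ENNReal.coe_mul, ENNReal.coe_le_coe]
      have hlam3 : g (8 * ρ) ^ κ ≤ lam ^ 3 * g ρ ^ κ := by
        calc g (8 * ρ) ^ κ ≤ (lam ^ 3 * g ρ) ^ κ :=
              NNReal.rpow_le_rpow (G.map_eight_mul_le ρ) hκ0
          _ = (lam ^ 3) ^ κ * g ρ ^ κ := NNReal.mul_rpow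
          _ ≤ (lam ^ 3) ^ (1 : ℝ) * g ρ ^ κ := by
              gcongr
              · exact one_le_pow₀ G.one_le_lam
          _ = _ := by rw [NNReal.rpow_one]
      calc f δ * (c₄ * (g δ ^ (1 - κ) * g (8 * ρ) ^ κ))
          ≤ f δ * (c₄ * (g δ ^ (1 - κ) * (lam ^ 3 * g ρ ^ κ))) := by gcongr
        _ = c₄ * lam ^ 3 * g δ ^ (1 - κ) * (f δ * g ρ ^ κ) := by ring
        _ ≤ c₄ * lam ^ 3 * g δ ^ (1 - κ) * (f ρ * g δ ^ κ) := by
            exact mul_le_mul_right (hfκ δ ρ hδ hge) _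
        _ = c₄ * lam ^ 3 * (g δ ^ (1 - κ) * g δ ^ κ) * f ρ := by ring
        _ = c₄ * lam ^ 3 * g δ * f ρ := by rw [← hgδ]
        _ ≤ K * g δ * f ρ := by gcongr; exact le_add_self
  have hint : ((ε * f δ : ℝ≥0) : ℝ≥0∞) * μ E ≤ ((K * g δ * s : ℝ≥0) : ℝ≥0∞) := by
    calc ((ε * f δ : ℝ≥0) : ℝ≥0∞) * μ E
        = ∫⁻ y, E.indicator (fun _ => ((ε * f δ : ℝ≥0) : ℝ≥0∞)) y ∂μ :=
          (lintegral_indicator_const hEmeas _).symm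
      _ ≤ ∫⁻ y, ∑' p : I, (Metric.ball p.1.1 ((p.1.2 + δ : ℝ≥0) : ℝ) ∩ E).indicator
            (fun _ => ((min (f p.1.2) (f δ) : ℝ≥0) : ℝ≥0∞)) y ∂μ := lintegral_mono hpt
      _ = ∑' p : I, ((min (f p.1.2) (f δ) : ℝ≥0) : ℝ≥0∞) *
            μ (Metric.ball p.1.1 ((p.1.2 + δ : ℝ≥0) : ℝ) ∩ E) := by
          have hm : ∀ p : I, MeasurableSet (Metric.ball p.1.1 ((p.1.2 + δ : ℝ≥0) : ℝ) ∩ E) :=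
            fun p => Metric.isOpen_ball.measurableSet.inter hEmeas
          rw [lintegral_tsum fun p => (measurable_const.indicator (hm p)).aemeasurable]
          exact tsum_congr fun p => lintegral_indicator_const (hm p) _
      _ ≤ ∑' p : I, ((K * g δ : ℝ≥0) : ℝ≥0∞) * f p.1.2 := ENNReal.tsum_le_tsum hterm
      _ = ((K * g δ : ℝ≥0) : ℝ≥0∞) * ∑' p : I, (f p.1.2 : ℝ≥0∞) := ENNReal.tsum_mul_left
      _ ≤ ((K * g δ : ℝ≥0) : ℝ≥0∞) * s := by gcongr
      _ = _ := (ENNReal.coe_mul _ _).symm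
  have hlow := (hA R δ (hδ.trans hδR) hR hδR x hx).1
  rw [hμ, hausdorffMeasure_apply _ hEmeas] at hint
  have hfinal := (mul_le_mul_right hlow ((ε * f δ : ℝ≥0) : ℝ≥0∞)).trans hint
  rw [← ENNReal.coe_mul, ENNReal.coe_le_coe] at hfinal
  have hpos : 0 < g δ ^ (1 - κ) := NNReal.rpow_pos (G.pos _ hδ)
  refine absurd hfinal (not_le.2 ?_)
  calc K * g δ * s = g δ ^ (1 - κ) * (K * s * g δ ^ κ) := by
        conv_lhs => rw [hgδ]
        ring
    _ < g δ ^ (1 - κ) * (ε * c₃ * f δ * g R ^ κ) := by gcongr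
    _ = _ := by ring

/-- One step of the nested construction: inside a closed ball that is hit by few balls of `C` there
is a much smaller one with the same property, contained in one of the neighbourhoods. -/
theorem exists_next_ball [MeasurableSpace X] [BorelSpace X]
    (G : RegularGauge X g lam c₁ c₂ r₀) {F : ℕ → Set X} {κ : ℝ} (hκ0 : 0 ≤ κ) (hκ1 : κ < 1)
    {c₃ c₄ r₁ : ℝ≥0} (hc₃ : 0 < c₃)
    (hF : ∀ r δ : ℝ≥0, 0 < r → r < r₁ → δ < r → ∀ j, ∀ x ∈ F j,
      ((c₃ * (g δ ^ (1 - κ) * g r ^ κ) : ℝ≥0) : ℝ≥0∞) ≤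
        hausdorffMeas g (Metric.ball x (r : ℝ) ∩ nbhd (F j) δ) ∧
      hausdorffMeas g (Metric.ball x (r : ℝ) ∩ nbhd (F j) δ) ≤
        ((c₄ * (g δ ^ (1 - κ) * g r ^ κ) : ℝ≥0) : ℝ≥0∞))
    {Υ Υ' : ℕ → ℝ≥0} (hΥ' : Tendsto Υ' atTop (𝓝 0)) (hle : ∀ᶠ j in atTop, Υ j ≤ Υ' j)
    {f : ℝ≥0 → ℝ≥0} (hf : Monotone f) (hf0 : f 0 = 0) (hfpos : ∀ r, 0 < r → 0 < f r)
    (hfκ : ∀ a b, 0 < a → a ≤ b → f a * g b ^ κ ≤ f b * g a ^ κ)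
    (hfg : ∀ a b, 0 < a → a ≤ b → f b * g a ≤ f a * g b)
    (hΥf : ∀ᶠ j in atTop, g (Υ' j) ^ (1 - κ) ≤ f (Υ j) / g (Υ j) ^ κ)
    {ε : ℝ≥0} (hε0 : 0 < ε) (hε1 : ε < 1) (hε : c₂ * lam ^ 3 * ε < c₁)
    {C : Set (X × ℝ≥0)} (hC : C.Countable) (hCpos : ∀ p ∈ C, 0 < p.2)
    (hCsum : ∑' p : C, (f p.1.2 : ℝ≥0∞) ≠ ⊤)
    {z : X} {R : ℝ≥0} (hR0 : 0 < R) (hRr₀ : 4 * R < r₀) (hRr₁ : 8 * R < r₁)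
    (hfull : hausdorffMeas g (Metric.ball z ((R / 2 : ℝ≥0) : ℝ) \ limsupSet F Υ') = 0)
    (hz : ∑' p : hitting C z R, (g p.1.2 : ℝ≥0∞) ≤ (ε * g R : ℝ≥0)) (n : ℕ) :
    ∃ (y : X) (δ : ℝ≥0) (j : ℕ), n ≤ j ∧ 0 < δ ∧ 2 * δ ≤ R ∧
      Metric.closedBall y (δ : ℝ) ⊆ Metric.closedBall z (R : ℝ) ∧
      Metric.closedBall y (δ : ℝ) ⊆ nbhd (F j) (Υ j) ∧
      ∑' p : hitting C y δ, (g p.1.2 : ℝ≥0∞) ≤ (ε * g δ : ℝ≥0) := by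
  have hlam := one_pos.trans_le G.one_le_lam
  have hlt : ∀ p ∈ hitting C z R, p.2 < R := by
    intro p hp
    refine G.mono.reflect_lt ?_
    have h1 : (g p.2 : ℝ≥0∞) ≤ (ε * g R : ℝ≥0) :=
      (ENNReal.le_tsum (f := fun p : hitting C z R => (g p.1.2 : ℝ≥0∞)) ⟨p, hp⟩).trans hz
    exact (ENNReal.coe_le_coe.1 h1).trans_lt (mul_lt_of_lt_one_left (G.pos _ hR0) hε1)
  have hcount : (hitting C z R).Countable := hC.mono (sep_subset _ _)
  -- Of the factor `lam ^ 3` in `hε`, quadrupling the hitting balls uses `lam ^ 2` and passing from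
  -- `R` to `R / 2` uses the rest.
  set W := ⋃ p ∈ hitting C z R, Metric.ball p.1 ((4 * p.2 : ℝ≥0) : ℝ)
  have hWmeas : hausdorffMeas g W < hausdorffMeas g (Metric.ball z ((R / 2 : ℝ≥0) : ℝ)) := by
    have hhalf : R / 2 < r₀ := by
      rw [← NNReal.coe_lt_coe] at *; push_cast at *; linarith
    refine lt_of_lt_of_le ?_ (G.lower z (R / 2) (half_pos hR0) hhalf)
    calc hausdorffMeas g W ≤ ∑' p : hitting C z R,
          hausdorffMeas g (Metric.ball p.1.1 ((4 * p.1.2 : ℝ≥0) : ℝ)) :=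
          measure_biUnion_le (hausdorffOuter X g) hcount _
      _ ≤ ∑' p : hitting C z R, ((c₂ * lam ^ 2 : ℝ≥0) : ℝ≥0∞) * g p.1.2 := by
          refine ENNReal.tsum_le_tsum fun p => ?_
          have h4 : 4 * p.1.2 < r₀ := (mul_le_mul_right (hlt p.1 p.2).le 4).trans_lt hRr₀
          refine (G.upper_of_lt _ h4).trans ?_
          rw [← ENNReal.coe_mul, ENNReal.coe_le_coe, mul_assoc]
          gcongr
          exact G.map_four_mul_le _
      _ = ((c₂ * lam ^ 2 : ℝ≥0) : ℝ≥0∞) * ∑' p : hitting C z R, (g p.1.2 : ℝ≥0∞) :=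
          ENNReal.tsum_mul_left
      _ ≤ ((c₂ * lam ^ 2 : ℝ≥0) : ℝ≥0∞) * (ε * g R : ℝ≥0) := by gcongr
      _ < _ := by
          rw [← ENNReal.coe_mul, ENNReal.coe_lt_coe]
          have h2 : g R ≤ lam * g (R / 2) := by
            have := G.doubling (R / 2)
            rwa [mul_div_cancel₀ _ two_ne_zero] at this
          have h3 : 0 < g (R / 2) := G.pos _ (half_pos hR0)
          calc c₂ * lam ^ 2 * (ε * g R) ≤ c₂ * lam ^ 2 * (ε * (lam * g (R / 2))) := by gcongr
            _ = (c₂ * lam ^ 3 * ε) * g (R / 2) := by ring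
            _ < _ := by gcongr
  set K := c₂ * lam + c₄ * lam ^ 3
  have hKpos : 0 < K := by have := G.c₂_pos; positivity
  -- Chosen for `hsmall`: `lam` pays for `f (2 * δ) ≤ lam * f δ`, and the `2` makes the inequality
  -- strict. The `lam ^ 3` in `c` below pays for testing the density at radius `8 * T`.
  set ε' := ε * c₃ / (2 * K * lam) with hε'
  have hε'pos : 0 < ε' := by positivity
  set c := ε' / lam ^ 3 with hc
  have hcpos : 0 < c := by positivity
  set bad := {x | (∀ p ∈ C, p.1 ≠ x) ∧ ∀ ε : ℝ≥0, 0 < ε → ∃ r : ℝ≥0, 0 < r ∧ r < ε ∧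
      ((c * g r : ℝ≥0) : ℝ≥0∞) ≤ ∑' p : {p ∈ C | dist p.1 x ≤ r}, (f p.1.2 : ℝ≥0∞)}
  have hbad0 : hausdorffMeas g bad = 0 :=
    G.hausdorffMeas_upperDensity_eq_zero (w := fun p => (f p.2 : ℝ≥0∞)) hCsum hcpos
  obtain ⟨x, hxz, hxW, hxbad, hxΛ⟩ : ∃ x ∈ Metric.ball z ((R / 2 : ℝ≥0) : ℝ),
      x ∉ W ∧ x ∉ bad ∧ x ∈ limsupSet F Υ' := by
    by_contra! hno
    refine hWmeas.not_ge ?_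
    have hsub : Metric.ball z ((R / 2 : ℝ≥0) : ℝ) ⊆
        W ∪ (bad ∪ (Metric.ball z ((R / 2 : ℝ≥0) : ℝ) \ limsupSet F Υ')) := by
      intro x hx
      by_cases h1 : x ∈ W
      · exact Or.inl h1
      by_cases h2 : x ∈ bad
      · exact Or.inr (Or.inl h2)
      exact Or.inr (Or.inr ⟨hx, hno x hx h1 h2⟩)
    refine (hausdorffMeas_mono g hsub).trans ?_
    refine (measure_union_le (μ := hausdorffOuter X g) _ _).trans ?_
    have h3 : hausdorffOuter X g
        (bad ∪ (Metric.ball z ((R / 2 : ℝ≥0) : ℝ) \ limsupSet F Υ')) = 0 :=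
      measure_union_null hbad0 hfull
    rw [h3, add_zero, hausdorffOuter_apply]
  have hR0' : (0 : ℝ) < R := by exact_mod_cast hR0
  rw [Metric.mem_ball] at hxz
  push_cast at hxz
  have hxC : ∀ p ∈ C, p.1 ≠ x := by
    rintro p hp rfl
    refine hxW (mem_iUnion₂.2 ⟨p, ⟨hp, ?_⟩, Metric.mem_ball_self ?_⟩)
    · have := p.2.2
      linarith
    · exact_mod_cast mul_pos four_pos (hCpos p hp)
  have hdens : ∃ η : ℝ≥0, 0 < η ∧ ∀ r : ℝ≥0, 0 < r → r < η →
      ∑' p : {p ∈ C | dist p.1 x ≤ r}, (f p.1.2 : ℝ≥0∞) < (c * g r : ℝ≥0) := by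
    by_contra! hno
    exact hxbad ⟨hxC, hno⟩
  obtain ⟨η, hη, hdens⟩ := hdens
  have hm : 0 < min η R / 8 := by have := lt_min hη hR0; positivity
  obtain ⟨j, hxj, hnj, hlej, hΥfj, hj⟩ := ((mem_limsupSet_iff.1 hxΛ).and_eventually
    ((eventually_ge_atTop n).and (hle.and (hΥf.and (hΥ'.eventually (gt_mem_nhds hm)))))).exists
  set T := Υ' j
  -- With half the radius, a closed ball of radius `δ` centred in the `δ`-neighbourhood of `F j`
  -- stays in the `Υ j`-neighbourhood.
  set δ := Υ j / 2 with hδ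
  have hj8 : 8 * T < min η R := by
    have := (lt_div_iff₀ (by norm_num : (0 : ℝ≥0) < 8)).1 hj
    rwa [mul_comm]
  obtain ⟨v, hvF, hxv⟩ := mem_nbhd_iff.1 hxj
  have hTpos : 0 < T := by
    have : (0 : ℝ) < T := dist_nonneg.trans_lt hxv
    exact_mod_cast this
  have hΥpos : 0 < Υ j := by
    refine pos_iff_ne_zero.2 fun h0 => ?_
    rw [h0, hf0, zero_div] at hΥfj
    exact (NNReal.rpow_pos (G.pos _ hTpos)).not_ge hΥfj
  have hδpos : 0 < δ := half_pos hΥpos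
  have h2δ : 2 * δ = Υ j := mul_div_cancel₀ _ two_ne_zero
  have hT8 : 8 * (T : ℝ) < min (η : ℝ) R := by exact_mod_cast hj8
  have hTη : 8 * (T : ℝ) < η := hT8.trans_le (min_le_left _ _)
  have hTR : 8 * (T : ℝ) < R := hT8.trans_le (min_le_right _ _)
  have hT0 : (0 : ℝ) < T := by exact_mod_cast hTpos
  have h2δT : 2 * (δ : ℝ) ≤ T := by rw [← h2δ] at hlej; exact_mod_cast hlej
  have hδ0 : (0 : ℝ) < δ := by exact_mod_cast hδpos
  have hRr₀' : 4 * (R : ℝ) < r₀ := by exact_mod_cast hRr₀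
  have hRr₁' : 8 * (R : ℝ) < r₁ := by exact_mod_cast hRr₁
  set I := {p ∈ hitting C z R | dist p.1 x ≤ (8 * T : ℝ≥0)}
  have hIsum : ∑' p : I, (f p.1.2 : ℝ≥0∞) ≤ (ε' * g T : ℝ≥0) := by
    have hsub : I ⊆ {p ∈ C | dist p.1 x ≤ (8 * T : ℝ≥0)} := fun p hp => ⟨hp.1.1, hp.2⟩
    refine (ENNReal.tsum_mono_subtype (fun p : X × ℝ≥0 => (f p.2 : ℝ≥0∞)) hsub).trans ?_
    refine (hdens (8 * T) (by positivity) (by exact_mod_cast hTη)).le.trans ?_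
    refine ENNReal.coe_le_coe.2 ?_
    calc c * g (8 * T) ≤ c * (lam ^ 3 * g T) := by gcongr; exact G.map_eight_mul_le T
      _ = _ := by rw [hc]; field_simp
  have hfδ : 0 < f δ := hfpos _ hδpos
  have hgδ : 0 < g δ := G.pos _ hδpos
  have hsmall : K * (ε' * g T) * g δ ^ κ < ε * c₃ * f δ * g T ^ κ := by
    have hgT : g T = g T ^ (1 - κ) * g T ^ κ := by
      rw [← NNReal.rpow_add (G.pos _ hTpos).ne']; simp
    -- Here the definition of `Υ'` enters, through `hΥf`.
    have h1 : g T ^ (1 - κ) * g δ ^ κ ≤ lam * f δ := by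
      have hδΥ : δ ≤ Υ j := by rw [← h2δ]; exact le_mul_of_one_le_left zero_le one_le_two
      have h2 : f (Υ j) * g δ ≤ lam * f δ * g δ := by
        calc f (Υ j) * g δ ≤ f δ * g (Υ j) := hfg _ _ hδpos hδΥ
          _ ≤ f δ * (lam * g δ) := by
              gcongr
              rw [← h2δ]
              exact G.doubling δ
          _ = _ := by ring
      calc g T ^ (1 - κ) * g δ ^ κ ≤ g T ^ (1 - κ) * g (Υ j) ^ κ := by
            gcongr
            exact G.mono hδΥ
        _ ≤ f (Υ j) := (le_div_iff₀ (NNReal.rpow_pos (G.pos _ hΥpos))).1 hΥfj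
        _ ≤ lam * f δ := le_of_mul_le_mul_right h2 hgδ
    have hgTκ : 0 < g T ^ κ := NNReal.rpow_pos (G.pos _ hTpos)
    calc K * (ε' * g T) * g δ ^ κ = K * ε' * g T ^ κ * (g T ^ (1 - κ) * g δ ^ κ) := by
          conv_lhs => rw [hgT]
          ring
      _ ≤ K * ε' * g T ^ κ * (lam * f δ) := by gcongr
      _ = (ε * c₃ * f δ * g T ^ κ) / 2 := by rw [hε']; field_simp
      _ < _ := NNReal.half_lt_self (by positivity)
  obtain ⟨y, ⟨hyv, hyF⟩, hy⟩ := G.exists_point_few_hits hκ0 hκ1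
    (fun r δ hr hr' hδ x hx => hF r δ hr hr' hδ j x hx) hfκ hδpos (R := T)
    (by rw [← NNReal.coe_lt_coe]; linarith) (by rw [← NNReal.coe_lt_coe]; push_cast; linarith)
    (by rw [← NNReal.coe_lt_coe]; linarith) hvF (I := I) (hcount.mono (sep_subset _ _))
    (fun p hp => (mul_le_mul_right (hlt p hp.1).le 8).trans_lt hRr₁) hIsum hsmall
  rw [Metric.mem_ball] at hyv
  have hyx : dist y x < 2 * T := by
    have := dist_triangle_right y x v
    linarith
  have hyz : dist y z + δ ≤ R := by
    have := dist_triangle y x z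
    linarith
  -- As `x ∉ W`, a ball hitting near `y` has `4 * p.2 ≤ dist p.1 x < p.2 + 3 * T`; so `p.2 < T`, and
  -- its centre is within `4 * T` of `x`.
  have hIhit : hitting C y δ ⊆ hitting I y δ := by
    rintro p ⟨hpC, hpy⟩
    have hpz : p ∈ hitting C z R := by
      refine ⟨hpC, ?_⟩
      have := dist_triangle p.1 y z
      linarith
    have hpx : dist p.1 x < p.2 + 3 * T := by
      have := dist_triangle p.1 y x
      linarith
    have hpW : 4 * (p.2 : ℝ) ≤ dist p.1 x := by
      by_contra! hlt
      refine hxW (mem_iUnion₂.2 ⟨p, hpz, ?_⟩)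
      rw [Metric.mem_ball, dist_comm]
      exact_mod_cast hlt
    refine ⟨⟨hpz, ?_⟩, hpy⟩
    push_cast
    linarith
  -- A ball violating this would alone contribute `f δ` to a sum below `ε * f δ`. So the minima are
  -- all `f p.2`, and antitonicity of `f / g` turns `f`-mass into `g`-mass.
  have hlow : ∀ p ∈ hitting I y δ, f p.2 < f δ := by
    intro p hp
    by_contra! hge
    have h1 := ENNReal.le_tsum
      (f := fun p : hitting I y δ => ((min (f p.1.2) (f δ) : ℝ≥0) : ℝ≥0∞)) ⟨p, hp⟩
    simp only [min_eq_right hge] at h1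
    have h2 := ENNReal.coe_lt_coe.1 (h1.trans_lt hy)
    exact h2.not_ge (mul_le_of_le_one_left zero_le hε1.le)
  refine ⟨y, δ, j, hnj, hδpos, ?_, Metric.closedBall_subset_closedBall' (by linarith), ?_, ?_⟩
  · rw [← NNReal.coe_le_coe]; push_cast; linarith
  · intro a ha
    obtain ⟨b, hb, hyb⟩ := mem_nbhd_iff.1 hyF
    refine mem_nbhd_iff.2 ⟨b, hb, ?_⟩
    rw [Metric.mem_closedBall] at ha
    have := dist_triangle a y b
    rw [← h2δ]
    push_cast
    linarith
  · calc ∑' p : hitting C y δ, (g p.1.2 : ℝ≥0∞) ≤ ∑' p : hitting I y δ, (g p.1.2 : ℝ≥0∞) :=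
          ENNReal.tsum_mono_subtype (fun p : X × ℝ≥0 => (g p.2 : ℝ≥0∞)) hIhit
      _ ≤ ∑' p : hitting I y δ, ((g δ / f δ : ℝ≥0) : ℝ≥0∞) *
            ((min (f p.1.2) (f δ) : ℝ≥0) : ℝ≥0∞) := by
          refine ENNReal.tsum_le_tsum fun p => ?_
          have hp := hlow p.1 p.2
          rw [min_eq_left hp.le, ← ENNReal.coe_mul, ENNReal.coe_le_coe, div_mul_eq_mul_div,
            le_div_iff₀ hfδ, mul_comm, mul_comm (g δ)]
          exact hfg _ _ (hCpos _ p.2.1.1.1) (hf.reflect_lt hp).le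
      _ = ((g δ / f δ : ℝ≥0) : ℝ≥0∞) *
            ∑' p : hitting I y δ, ((min (f p.1.2) (f δ) : ℝ≥0) : ℝ≥0∞) := ENNReal.tsum_mul_left
      _ ≤ ((g δ / f δ : ℝ≥0) : ℝ≥0∞) * (ε * f δ : ℝ≥0) := by gcongr
      _ = _ := by
          rw [← ENNReal.coe_mul]
          congr 1
          field_simp

end RegularGauge

end MTP

/-! ### The nested construction and the final case distinction. -/

namespace MTP

namespace RegularGauge

variable {X : Type*} [MetricSpace X] {g : ℝ≥0 → ℝ≥0} {lam c₁ c₂ r₀ : ℝ≥0}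

/-- If `f / g` tends to infinity at zero, then the limsup set has infinite `f`-measure in every
ball. -/
theorem hausdorffMeas_ball_inter_limsupSet_eq_top [LocallyCompactSpace X]
    [MeasurableSpace X] [BorelSpace X]
    (G : RegularGauge X g lam c₁ c₂ r₀) {F : ℕ → Set X} {κ : ℝ} (hκ0 : 0 ≤ κ) (hκ1 : κ < 1)
    {c₃ c₄ r₁ : ℝ≥0} (hc₃ : 0 < c₃) (hr₁ : 0 < r₁)
    (hF : ∀ r δ : ℝ≥0, 0 < r → r < r₁ → δ < r → ∀ j, ∀ x ∈ F j,
      ((c₃ * (g δ ^ (1 - κ) * g r ^ κ) : ℝ≥0) : ℝ≥0∞) ≤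
        hausdorffMeas g (Metric.ball x (r : ℝ) ∩ nbhd (F j) δ) ∧
      hausdorffMeas g (Metric.ball x (r : ℝ) ∩ nbhd (F j) δ) ≤
        ((c₄ * (g δ ^ (1 - κ) * g r ^ κ) : ℝ≥0) : ℝ≥0∞))
    {Υ Υ' : ℕ → ℝ≥0} (hΥ' : Tendsto Υ' atTop (𝓝 0)) (hle : ∀ᶠ j in atTop, Υ j ≤ Υ' j)
    {f : ℝ≥0 → ℝ≥0} (hf : Monotone f) (hf0 : f 0 = 0) (hfpos : ∀ r, 0 < r → 0 < f r)
    (hfκ : ∀ a b, 0 < a → a ≤ b → f a * g b ^ κ ≤ f b * g a ^ κ)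
    (hfg : ∀ a b, 0 < a → a ≤ b → f b * g a ≤ f a * g b)
    (hlarge : ∀ T : ℝ≥0, ∃ ρ : ℝ≥0, 0 < ρ ∧ ∀ r, 0 < r → r < ρ → T * g r ≤ f r)
    (hΥf : ∀ᶠ j in atTop, g (Υ' j) ^ (1 - κ) ≤ f (Υ j) / g (Υ j) ^ κ)
    (hnull : ∀ (x : X) (r : ℝ≥0), 0 < r → r < r₀ →
      hausdorffMeas g (Metric.ball x (r : ℝ) \ limsupSet F Υ') = 0)
    (x : X) {r : ℝ} (hr : 0 < r) :
    hausdorffMeas f (Metric.ball x r ∩ limsupSet F Υ) = ⊤ := by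
  by_contra htop
  have hlam := one_pos.trans_le G.one_le_lam
  have hc₁ := G.c₁_pos
  have hc₂ := G.c₂_pos
  obtain ⟨ε, hε0, hε1, hε⟩ : ∃ ε : ℝ≥0, 0 < ε ∧ ε < 1 ∧ c₂ * lam ^ 3 * ε < c₁ := by
    have hpos : 0 < c₁ / (c₂ * lam ^ 3) := by positivity
    obtain ⟨ε, h0, h⟩ := exists_between (lt_min one_pos hpos)
    refine ⟨ε, h0, h.trans_le (min_le_left _ _), ?_⟩
    have := (lt_div_iff₀ (by positivity)).1 (h.trans_le (min_le_right _ _))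
    rwa [mul_comm]
  obtain ⟨s, hs0, hscomp⟩ := Metric.exists_isCompact_closedBall x
  lift s to ℝ≥0 using hs0.le
  have hs0 : 0 < s := by exact_mod_cast hs0
  lift r to ℝ≥0 using hr.le
  have hr : 0 < r := by exact_mod_cast hr
  obtain ⟨R, hR0, hR⟩ := exists_between (lt_min (lt_min hs0 hr)
    (lt_min (show 0 < r₀ / 4 by have := G.r₀_pos; positivity) (show 0 < r₁ / 8 by positivity)))
  have hRs : R ≤ s := (hR.trans_le ((min_le_left _ _).trans (min_le_left _ _))).le
  have hRr : R < r := hR.trans_le ((min_le_left _ _).trans (min_le_right _ _))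
  have hRr₀ : 4 * R < r₀ := by
    have := hR.trans_le ((min_le_right _ _).trans (min_le_left _ _))
    rwa [lt_div_iff₀ (by norm_num), mul_comm] at this
  have hRr₁ : 8 * R < r₁ := by
    have := hR.trans_le ((min_le_right _ _).trans (min_le_right _ _))
    rwa [lt_div_iff₀ (by norm_num), mul_comm] at this
  have hcomp : IsCompact (Metric.closedBall x (R : ℝ)) :=
    hscomp.of_isClosed_subset Metric.isClosed_closedBall
      (Metric.closedBall_subset_closedBall (by exact_mod_cast hRs))
  obtain ⟨M, hM⟩ : ∃ M : ℝ≥0, (M : ℝ≥0∞) = _ := ⟨_, ENNReal.coe_toNNReal htop⟩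
  have hgR := G.pos R hR0
  -- With this constant, `f`-mass at most `M + 1` forces `g`-mass at most `ε * g R`, which starts
  -- the induction.
  obtain ⟨ρ, hρ, hρf⟩ := hlarge ((M + 1) / (ε * g R))
  obtain ⟨C₀, hC₀, hC₀sum⟩ := exists_cover_of_hausdorffPre_lt (a := ((M + 1 : ℝ≥0) : ℝ≥0∞))
    (((hausdorffPre_le_hausdorffMeas f hρ _).trans_eq hM.symm).trans_lt
      (ENNReal.coe_lt_coe.2 (lt_add_one M)))
  -- Balls of radius `0` are empty and cover nothing, but `exists_next_ball` needs positive radii.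
  set C := {p ∈ C₀ | 0 < p.2}
  have hCC₀ : C ⊆ C₀ := sep_subset _ _
  have hCcount : C.Countable := hC₀.1.mono hCC₀
  have hCpos : ∀ p ∈ C, 0 < p.2 := fun p hp => hp.2
  have hCsum : ∑' p : C, (f p.1.2 : ℝ≥0∞) ≤ ((M + 1 : ℝ≥0) : ℝ≥0∞) :=
    (ENNReal.tsum_mono_subtype (fun p : X × ℝ≥0 => (f p.2 : ℝ≥0∞)) hCC₀).trans hC₀sum.le
  have hCtop := ne_top_of_le_ne_top ENNReal.coe_ne_top hCsum
  have hstart : ∑' p : hitting C x R, (g p.1.2 : ℝ≥0∞) ≤ (ε * g R : ℝ≥0) := by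
    calc ∑' p : hitting C x R, (g p.1.2 : ℝ≥0∞) ≤ ∑' p : C, (g p.1.2 : ℝ≥0∞) :=
          ENNReal.tsum_mono_subtype (fun p : X × ℝ≥0 => (g p.2 : ℝ≥0∞)) (sep_subset _ _)
      _ ≤ ∑' p : C, ((ε * g R / (M + 1) : ℝ≥0) : ℝ≥0∞) * f p.1.2 := by
          refine ENNReal.tsum_le_tsum fun p => ?_
          have := hρf _ (hCpos _ p.2) (hC₀.2.1 _ (hCC₀ p.2))
          rw [← ENNReal.coe_mul, ENNReal.coe_le_coe]
          calc g p.1.2 = ε * g R / (M + 1) * ((M + 1) / (ε * g R) * g p.1.2) := by field_simp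
            _ ≤ _ := by gcongr
      _ = ((ε * g R / (M + 1) : ℝ≥0) : ℝ≥0∞) * ∑' p : C, (f p.1.2 : ℝ≥0∞) :=
          ENNReal.tsum_mul_left
      _ ≤ ((ε * g R / (M + 1) : ℝ≥0) : ℝ≥0∞) * ((M + 1 : ℝ≥0) : ℝ≥0∞) := by gcongr
      _ = _ := by rw [← ENNReal.coe_mul, div_mul_cancel₀ _ (by positivity)]
  let St := {q : X × ℝ≥0 // 0 < q.2 ∧ q.2 ≤ R ∧
    ∑' p : hitting C q.1 q.2, (g p.1.2 : ℝ≥0∞) ≤ (ε * g q.2 : ℝ≥0)}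
  have step : ∀ (n : ℕ) (q : St), ∃ q' : St, ∃ j, n ≤ j ∧ 2 * q'.1.2 ≤ q.1.2 ∧
      Metric.closedBall q'.1.1 (q'.1.2 : ℝ) ⊆ Metric.closedBall q.1.1 (q.1.2 : ℝ) ∧
      Metric.closedBall q'.1.1 (q'.1.2 : ℝ) ⊆ nbhd (F j) (Υ j) := by
    rintro n ⟨⟨z, R'⟩, hR'0, hR'R, hq⟩
    have hhalf : R' / 2 < r₀ := by
      refine lt_of_le_of_lt ?_ hRr₀
      calc R' / 2 ≤ R' := half_le_self zero_le
        _ ≤ R := hR'R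
        _ ≤ 4 * R := le_mul_of_one_le_left zero_le (by norm_num)
    obtain ⟨y, δ, j, hnj, hδ, h2δ, hsub, hsubF, hy⟩ := G.exists_next_ball hκ0 hκ1 hc₃ hF hΥ' hle hf
      hf0 hfpos hfκ hfg hΥf hε0 hε1 hε hCcount hCpos hCtop hR'0
      ((mul_le_mul_right hR'R 4).trans_lt hRr₀) ((mul_le_mul_right hR'R 8).trans_lt hRr₁)
      (hnull z (R' / 2) (half_pos hR'0) hhalf) hq n
    refine ⟨⟨⟨y, δ⟩, hδ, ?_, hy⟩, j, hnj, h2δ, hsub, hsubF⟩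
    exact (le_mul_of_one_le_left zero_le one_le_two).trans (h2δ.trans hR'R)
  choose next idx hidx hnext hsub hsubF using step
  let q : ℕ → St := fun n => Nat.rec ⟨⟨x, R⟩, hR0, le_rfl, hstart⟩ (fun n s => next n s) n
  have hq : ∀ n, q (n + 1) = next n (q n) := fun n => rfl
  have hqR : ∀ n, (q n).1.2 * 2 ^ n ≤ R := by
    intro n
    induction n with
    | zero => exact (mul_one R).le
    | succ n ih =>
      refine le_trans ?_ ih
      calc (q (n + 1)).1.2 * 2 ^ (n + 1) = 2 * (next n (q n)).1.2 * 2 ^ n := by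
            rw [hq, pow_succ]; ring
        _ ≤ _ := by gcongr; exact hnext n (q n)
  obtain ⟨w, hw⟩ := IsCompact.nonempty_iInter_of_sequence_nonempty_isCompact_isClosed
    (fun n => Metric.closedBall (q n).1.1 ((q n).1.2 : ℝ)) (fun n => hsub n (q n))
    (fun n => ⟨_, Metric.mem_closedBall_self (q n).1.2.2⟩) hcomp
    (fun n => Metric.isClosed_closedBall)
  rw [mem_iInter] at hw
  have hwΛ : w ∈ limsupSet F Υ := by
    rw [mem_limsupSet_iff, frequently_atTop]
    exact fun n => ⟨idx n (q n), hidx n (q n), hsubF n (q n) (hw (n + 1))⟩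
  have hwr : w ∈ Metric.ball x (r : ℝ) :=
    Metric.closedBall_subset_ball (by exact_mod_cast hRr) (hw 0)
  obtain ⟨p, hpC₀, hwp⟩ := mem_iUnion₂.1 (hC₀.2.2 ⟨hwr, hwΛ⟩)
  rw [Metric.mem_ball, dist_comm] at hwp
  have hp0 : 0 < p.2 := by exact_mod_cast dist_nonneg.trans_lt hwp
  -- The covering ball hits every nested ball, and its own `g`-mass is at most `ε * g` of the
  -- radius, with `ε < 1`.
  have hlt : ∀ n, p.2 < (q n).1.2 := by
    intro n
    have hhit : p ∈ hitting C (q n).1.1 (q n).1.2 := by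
      refine ⟨⟨hpC₀, hp0⟩, ?_⟩
      have h1 := Metric.mem_closedBall.1 (hw n)
      have h2 := dist_triangle p.1 w (q n).1.1
      linarith
    have h1 : (g p.2 : ℝ≥0∞) ≤ (ε * g (q n).1.2 : ℝ≥0) :=
      (ENNReal.le_tsum (f := fun p : hitting C (q n).1.1 (q n).1.2 => (g p.1.2 : ℝ≥0∞))
        ⟨p, hhit⟩).trans (q n).2.2.2
    exact G.mono.reflect_lt ((ENNReal.coe_le_coe.1 h1).trans_lt
      (mul_lt_of_lt_one_left (G.pos _ (q n).2.1) hε1))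
  obtain ⟨n, hn⟩ := pow_unbounded_of_one_lt (R / p.2) one_lt_two
  rw [div_lt_iff₀ hp0, mul_comm] at hn
  exact absurd (hn.trans_le ((mul_le_mul_left (hlt n).le _).trans (hqR n))) (lt_irrefl R)

end RegularGauge

/-- A single point where `f / g` is large suffices, since antitonicity spreads the bound to all
smaller radii. -/
theorem exists_forall_mul_le_of_antitoneOn {f g : ℝ≥0 → ℝ≥0} (hf0 : f 0 = 0)
    (hgpos : ∀ r, 0 < r → 0 < g r) (hanti : AntitoneOn (fun r => f r / g r) (Ioi 0))
    (hno : ¬ ∃ K ρ : ℝ≥0, 0 < K ∧ 0 < ρ ∧ ∀ r < ρ, f r ≤ K * g r) (T : ℝ≥0) :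
    ∃ ρ : ℝ≥0, 0 < ρ ∧ ∀ r, 0 < r → r < ρ → T * g r ≤ f r := by
  push Not at hno
  obtain ⟨ρ, -, hρ⟩ := hno (T + 1) 1 (by positivity) one_pos
  have hρ0 : 0 < ρ := by
    refine pos_iff_ne_zero.2 fun h0 => ?_
    rw [h0, hf0] at hρ
    exact not_lt_zero hρ
  refine ⟨ρ, hρ0, fun r hr hrρ => ?_⟩
  have h1 : f ρ / g ρ ≤ f r / g r := hanti hr hρ0 hrρ.le
  have h2 : T + 1 ≤ f ρ / g ρ := (le_div_iff₀ (hgpos _ hρ0)).2 hρ.le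
  exact (le_div_iff₀ (hgpos _ hr)).1 ((le_add_of_nonneg_right zero_le).trans (h2.trans h1))

end MTP

theorem theorem1 {X : Type*} [MetricSpace X] [LocallyCompactSpace X]
    (g : ℝ≥0 → ℝ≥0) (hg : MTP.IsDimensionFunction g) (hgd : MTP.IsDoubling g)
    (hgb : MTP.BallMeasureComparable X g)
    (F : ℕ → Set X) (κ : ℝ) (hκ0 : 0 ≤ κ) (hκ1 : κ < 1) (hF : MTP.LocalScaling g F κ)
    (Υ : ℕ → ℝ≥0) (hΥ : Tendsto Υ atTop (𝓝 0))
    (f : ℝ≥0 → ℝ≥0) (hf : MTP.IsDimensionFunction f)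
    (hfg : MonotoneOn (fun r => f r / g r) (Ioi 0) ∨ AntitoneOn (fun r => f r / g r) (Ioi 0))
    (hfgκ : MTP.IsDimensionFunction (fun r => f r / g r ^ κ))
    (hfull : ∀ (x : X) (r : ℝ),
      MTP.hausdorffMeas g (Metric.ball x r ∩ MTP.limsupSet F
        (fun j => MTP.genInv g ((f (Υ j) / g (Υ j) ^ κ) ^ (1 / (1 - κ))))) =
      MTP.hausdorffMeas g (Metric.ball x r)) :
    ∀ (x : X) (r : ℝ),
      MTP.hausdorffMeas f (Metric.ball x r ∩ MTP.limsupSet F Υ) =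
      MTP.hausdorffMeas f (Metric.ball x r) := by
  open MTP MeasureTheory in
  intro x r
  borelize X
  obtain ⟨lam, c₁, c₂, r₀, G⟩ := exists_regularGauge hg hgd hgb
  obtain ⟨c₃, c₄, r₁, hc₃, -, hr₁, hF⟩ := hF
  set y : ℕ → ℝ≥0 := fun j => (f (Υ j) / g (Υ j) ^ κ) ^ (1 / (1 - κ)) with hy
  set Υ' : ℕ → ℝ≥0 := fun j => genInv g (y j)
  have hκ : 0 < 1 - κ := sub_pos.2 hκ1
  have hyκ : ∀ j, y j ^ (1 - κ) = f (Υ j) / g (Υ j) ^ κ := fun j => by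
    rw [hy, ← NNReal.rpow_mul, one_div_mul_cancel hκ.ne', NNReal.rpow_one]
  have hysmall : ∀ t, 0 < t → ∀ᶠ j in atTop, y j < g t := by
    intro t ht
    obtain ⟨s, hs0, hs⟩ := hfgκ.exists_forall_lt (NNReal.rpow_pos (p := 1 - κ) (G.pos t ht))
    filter_upwards [hΥ.eventually (gt_mem_nhds hs0)] with j hj
    refine (NNReal.rpow_lt_rpow_iff hκ).1 ?_
    rw [hyκ]
    exact (hfgκ.mono hj.le).trans_lt hs
  have hΥ' : Tendsto Υ' atTop (𝓝 0) := by
    refine tendsto_order.2 ⟨fun a ha => absurd ha not_lt_zero, fun a ha => ?_⟩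
    filter_upwards [hysmall (a / 2) (half_pos ha)] with j hj
    exact (genInv_le hg.mono hj).trans_lt (NNReal.half_lt_self ha.ne')
  -- Full measure means null complement only where the measure is finite, hence `r < r₀`.
  have hnull : ∀ (x : X) (r : ℝ≥0), 0 < r → r < r₀ →
      hausdorffMeas g (Metric.ball x (r : ℝ) \ limsupSet F Υ') = 0 := by
    intro x r _ hr
    have hB : MeasurableSet (Metric.ball x (r : ℝ)) := Metric.isOpen_ball.measurableSet
    have hΛ := measurableSet_limsupSet F Υ'
    have h1 := measure_inter_add_sdiff (μ := hausdorffMeasure X g) (Metric.ball x (r : ℝ)) hΛ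
    rw [hausdorffMeasure_apply _ (hB.inter hΛ), hausdorffMeasure_apply _ (hB.diff hΛ),
      hausdorffMeasure_apply _ hB, hfull x r] at h1
    have hfin : hausdorffMeas g (Metric.ball x (r : ℝ)) ≠ ⊤ :=
      ne_top_of_le_ne_top ENNReal.coe_ne_top (G.upper_of_lt x hr)
    exact (ENNReal.add_right_inj hfin).1 (h1.trans (add_zero _).symm)
  by_cases hbd : ∃ K ρ : ℝ≥0, 0 < K ∧ 0 < ρ ∧ ∀ r < ρ, f r ≤ K * g r
  · obtain ⟨K, ρ, hK, hρ, h⟩ := hbd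
    refine G.hausdorffMeas_ball_inter_eq hK.ne' hρ h G.r₀_pos (fun x r hr0 hr => ?_) x r
    refine G.hausdorffMeas_ball_diff_limsupSet hΥ' (NNReal.rpow_pos (p := 1 / (1 - κ)) hK) ?_ hr
      (hnull x r hr0 hr)
    filter_upwards [hΥ.eventually (gt_mem_nhds hρ)] with j hj
    refine (map_genInv_le hg (y j)).trans ((NNReal.rpow_le_rpow_iff hκ).1 ?_)
    rw [hyκ, NNReal.mul_rpow, ← NNReal.rpow_mul, one_div_mul_cancel hκ.ne', NNReal.rpow_one]
    rcases eq_or_ne (Υ j) 0 with h0 | h0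
    · rw [h0, hf.map_zero, zero_div]
      exact zero_le
    · have hg0 := G.pos _ (pos_iff_ne_zero.2 h0)
      rw [div_le_iff₀ (NNReal.rpow_pos hg0), mul_assoc, ← NNReal.rpow_add hg0.ne']
      simpa using h _ hj
  -- A non-decreasing `f / g` would be bounded on `(0, 1)` by its value at `1`.
  · have hanti : AntitoneOn (fun r => f r / g r) (Ioi 0) := by
      refine hfg.resolve_left fun hmono => hbd ⟨f 1 / g 1 + 1, 1, by positivity, one_pos, ?_⟩
      intro r hr
      rcases eq_or_ne r 0 with rfl | h0
      · rw [hf.map_zero]; exact zero_le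
      · have hr0 := pos_iff_ne_zero.2 h0
        have h1 : f r / g r ≤ f 1 / g 1 := hmono hr0 (mem_Ioi.2 one_pos) hr.le
        exact (div_le_iff₀ (G.pos _ hr0)).1 (h1.trans (le_add_of_nonneg_right zero_le))
    have hlarge := exists_forall_mul_le_of_antitoneOn hf.map_zero G.pos hanti hbd
    obtain ⟨ρ, hρ, hfge⟩ := hlarge 1
    have hfpos : ∀ r, 0 < r → 0 < f r := by
      intro r hr
      obtain ⟨s, hs0, hs⟩ := exists_between (lt_min hr hρ)
      have h1 := hfge s hs0 (hs.trans_le (min_le_right _ _))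
      rw [one_mul] at h1
      exact (G.pos s hs0).trans_le (h1.trans (hf.mono (hs.trans_le (min_le_left _ _)).le))
    rcases le_or_gt r 0 with hr | hr
    · rw [Metric.ball_eq_empty.2 hr, empty_inter]
    have htop : hausdorffMeas f (Metric.ball x r ∩ limsupSet F Υ) = ⊤ := by
      refine G.hausdorffMeas_ball_inter_limsupSet_eq_top hκ0 hκ1 hc₃ hr₁ hF hΥ' ?_ hf.mono
        hf.map_zero hfpos (fun a b ha hab => ?_) (fun a b ha hab => ?_) hlarge ?_ hnull x hr
      · filter_upwards [hΥ.eventually (gt_mem_nhds hρ), hysmall 1 one_pos] with j hj hj1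
        rcases eq_or_ne (Υ j) 0 with h0 | h0
        · rw [h0]; exact zero_le
        have h0 := pos_iff_ne_zero.2 h0
        have hg0 := G.pos _ h0
        refine le_genInv hg.mono ((NNReal.rpow_le_rpow_iff hκ).1 ?_) hj1
        rw [hyκ, le_div_iff₀ (NNReal.rpow_pos hg0), ← NNReal.rpow_add hg0.ne']
        simpa using hfge _ h0 hj
      · have hb := ha.trans_le hab
        exact (div_le_div_iff₀ (NNReal.rpow_pos (G.pos a ha)) (NNReal.rpow_pos (G.pos b hb))).1
          (hfgκ.mono hab)
      · have hb := ha.trans_le hab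
        exact (div_le_div_iff₀ (G.pos b hb) (G.pos a ha)).1 (hanti ha hb hab)
      · refine Eventually.of_forall fun j => ?_
        rw [← hyκ]
        exact NNReal.rpow_le_rpow (map_genInv_le hg (y j)) hκ.le
    rw [htop]
    exact (top_le_iff.1 (htop.symm.le.trans (hausdorffMeas_mono f inter_subset_left))).symm
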